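/- **Setting.** $\mathcal V$, $\mathcal M$, $\mathcal R$ are finite sets of compute nodes, models and request types; the nodes form a graph. Each model serves one task, and $\mathcal M_i$ is the set of models of task $i$. Model $m$ has size $s^v_m>0$ and maximum capacity $L^v_m\in\mathbb N$ on node $v$, and node $v$ has budget $b^v>0$; put $\|s^v\|_1=\sum_m s^v_m$. A request type $\rho=(i,p)$ is a task with a simple routing path $p=(p_1,\dots,p_J)$; $\nu(p)=p_J$. Serving it at $p_j$ with $m\in\mathcal M_i$ costs $C^{p_j}_{p,m}=f((p_1,\dots,p_j),m)$, with $f$ an arbitrary real function. The minimal allocation $\omega\in\{0,1\}^{\mathcal V\times\mathcal M}$ describes the permanently deployed repository models: each node hosts at most one repository model of each task, and for $\rho=(i,p)$ the node $\nu(p)$ hosts one of task $i$. An input is a pair $(r,l)$ of request numbers $r_\rho\in\mathbb N_0$ and potential available capacities $l^v_{\rho,m}\in\mathbb N_0$. The adversary's set $\mathcal A$ consists of the inputs such that $\sum_{\rho\in\mathcal R_i}r_\rho\le\sum_{m\in\mathcal M_i}\omega^v_mL^v_m$ for every task $i$ and every node $v$ hosting a repository model of task $i$ (where $\mathcal R_i$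 is the set of request types for task $i$), $l^v_{\rho,m}\le\min\{L^v_m,r_\rho\}$ always, and $l^v_{\rho,m}=\min\{L^v_m,r_\rho\}$ when $\omega^v_m=1$ and $m$ serves the task of $\rho$. For $\rho=(i,p)$ order the $K_\rho=|p|\,|\mathcal M_i|$ pairs $(v,m)$, $v\in p$, $m\in\mathcal M_i$, by increasing cost (ties broken arbitrarily but fixed). Let $\kappa_\rho(v,m)$ be the rank of $(v,m)$ ($\infty$ for other pairs), $\gamma^k_\rho$ the $k$-th cost, and $z^k_\rho(y)=y^v_m l^v_{\rho,m}$ for the $k$-th pair $(v,m)$. The cost of an allocation $y\in[0,1]^{\mathcal V\times\mathcal M}$ is $$C(r,l,y)=\sum_{\rho}\sum_{k=1}^{K_\rho}\gamma^k_\rho\,\min\Big\{r_\rho-\sum_{k'<k}z^{k'}_\rho(y),\,z^k_\rho(y)\Big\}\mathbf 1_{\{\sum_{k'<k}z^{k'}_\rho(y)<r_\rho\}},$$ and its gain is $G(r,l,y)=C(r,l,\omega)-C(r,l,y)$. Let $\mathcal X$ be the set of $x\in\{0,1\}^{\mathcal V\times\mathcal M}$ with $x\ge\omega$ and $\sum_m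 x^v_ms^v_m\le b^v$ for all $v$. Let $\mathcal Y^v$ be the set of $y\in[0,1]^{\mathcal M}$ with $y\ge\omega^v$ and $\sum_m y_ms^v_m=b^v$ if $\|s^v\|_1\ge b^v$, and $\mathcal Y^v=\{(1,\dots,1)\}$ otherwise. Assume that, with $\mathcal D^v=\mathbb R_{>0}^{\mathcal M}$, $\mathcal Y^v\cap\mathcal D^v\neq\emptyset$ for all $v$. **Algorithm (INFIDA)** with learning rate $\eta$. Let $\Phi^v(y)=\sum_m s^v_my_m\log y_m$. Start from $y^v_1=\arg\min_{\mathcal Y^v\cap\mathcal D^v}\Phi^v$. In slot $t$, with input $(r_t,l_t)$, let $$g^v_{t,m}=\sum_{\rho=(i,p)\in\mathcal R}l^{t,v}_{\rho,m}\big(\gamma_\rho^{K^*_\rho}-C^v_{p,m}\big)\mathbf 1_{\{\kappa_\rho(v,m)<K^*_\rho\}},$$ where $K^*_\rho$ is the least $k\le K_\rho$ with $\sum_{k'\le k}z^{k'}_\rho(y_t)\ge r^t_\rho$ or $k=K_\rho$; let $h^v_{t+1}\in\mathcal D^v$ be given by $\nabla\Phi^v(h^v_{t+1})=\nabla\Phi^v(y^v_t)+\eta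 g^v_t$, and let $y^v_{t+1}$ be the minimizer over $\mathcal Y^v\cap\mathcal D^v$ of the Bregman divergence $D_{\Phi^v}(\cdot,h^v_{t+1})$. In every slot $t$ each node independently draws $x^v_t\in\{0,1\}^{\mathcal M}$ from $y^v_t$ by DepRound: while two variables are fractional, take two fractional variables (chosen by any rule, possibly random) and shift size from one to the other, keeping $s^v_my_m+s^v_{m'}y_{m'}$ fixed, until one of them is integral, the direction being drawn with the probabilities that preserve expectations; a single remaining fractional variable is rounded to $1$ with probability equal to its value. **Theorem.** Let $R$, $L_{\max}$ be natural numbers and $\Delta_C\ge 0$ a real number such that: every input in $\mathcal A$ has at most $R$ request types with $r_\rho>0$ (for instance $R=|\mathcal R|$); $L^v_m\le L_{\max}$ for all $v,m$; and $\sum_{m'\in\mathcal M_i}\omega^{\nu(p)}_{m'}C^{\nu(p)}_{p,m'}-C^v_{p,m}\le\Delta_C$ for all $\rho=(i,p)\in\mathcal R$, $v\in p$, $m\in\mathcal M_i$. Let $s_{\min},s_{\max}$ be the least and largest $s^v_m$, and $$\sigma=\frac{RL_{\max}\Delta_C}{s_{\min}},\quad\theta=\frac1{s_{\max}|\mathcal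 V||\mathcal M|},\quad D_{\max}=\sum_{v}\min\{b^v,\|s^v\|_1\}\log\frac{\|s^v\|_1}{\min\{b^v,\|s^v\|_1\}}.$$ Then for every horizon $T$, INFIDA with $\eta=\frac1\sigma\sqrt{2\theta D_{\max}/T}$ ($\eta=0$ if $\sigma=0$ or $T=0$) satisfies $$\sup_{(r_t,l_t)_{t\le T}\in\mathcal A^T}\Big\{\big(1-\tfrac1e\big)\max_{x\in\mathcal X}\sum_{t=1}^TG(r_t,l_t,x)-\mathbb E\Big[\sum_{t=1}^TG(r_t,l_t,x_t)\Big]\Big\}\le A\sqrt T,$$ $$A=\Big(1-\frac1e\Big)\frac{RL_{\max}\Delta_C}{s_{\min}}\sqrt{s_{\max}|\mathcal V||\mathcal M|}\,\sqrt{2D_{\max}}.$$ -/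

import Mathlib

open MeasureTheory

noncomputable section

/-- An inference delivery network. `V` is the set of compute nodes, `N` the set of tasks, `M` the
catalog of models and `Req` the set of request types. -/
structure InferenceNetwork (V N M Req : Type*) where
  /-- the links between compute nodes -/
  graph : SimpleGraph V
  /-- the task a model is made for; the models of task `i` are the fibre over `i` -/
  taskOf : M → N
  /-- size of model `m` on node `v` -/
  size : V → M → ℝ
  size_pos : ∀ v m, 0 < size v m
  /-- allocation budget of a node -/
  budget : V → ℝ
  budget_pos : ∀ v, 0 < budget v
  /-- maximum number of requests model `m` can serve on node `v` in one slot -/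
  capacity : V → M → ℕ
  /-- requested task of a request type -/
  task : Req → N
  /-- routing path of a request type -/
  path : Req → List V
  path_ne_nil : ∀ ρ, path ρ ≠ []
  path_nodup : ∀ ρ, (path ρ).Nodup
  path_chain : ∀ ρ, (path ρ).IsChain graph.Adj
  /-- `costFn (p₁, …, pⱼ) m` is the cost of serving a request at `pⱼ` with model `m`, after it
  went through `p₁, …, pⱼ` -/
  costFn : List V → M → ℝ
  /-- the minimal allocation: which models are permanently deployed on which nodes -/
  repo : V → M → Bool
  /-- a node that is a repository node of a task runs one repository model of that task -/
  repo_unique : ∀ v m m', taskOf m = taskOf m' → repo v m = true → repo v m' = true → m = m'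
  /-- every routing path ends in a repository node of the requested task -/
  repo_end : ∀ ρ, ∃ m, taskOf m = task ρ ∧ repo ((path ρ).getLast (path_ne_nil ρ)) m = true

/-- A batch of requests `r_ρ` together with potential available capacities `l_{ρ,m}^v`. -/
abbrev Input (V M Req : Type*) := (Req → ℕ) × (Req → V → M → ℕ)

/-- The 0-1 vector of an integral allocation. -/
def toVec {V M : Type*} (x : V → M → Bool) : V → M → ℝ := fun v m => if x v m then 1 else 0

/-- A minimizer of `f` over `S` (an arbitrary element when there is none). -/
def argminOn {α : Type*} [Nonempty α] (f : α → ℝ) (S : Set α) : α :=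
  Classical.epsilon fun y => y ∈ S ∧ IsMinOn f S y

/-- Toss the coin `c`, then draw from `P` if it shows `true` and from `Q` otherwise. -/
def mixLaw {α : Type*} (c : PMF Bool) (P Q : PMF α) : PMF α :=
  c.bind fun b => if b then P else Q

/-- `IsDepRound s y P`: the law `P` of a random 0-1 vector can be produced by DepRound from the
fractional vector `y`, for model sizes `s`. As long as two variables are fractional, some pair of
fractional variables is taken (which pair may depend on the current state and may be random), and
size is moved from one to the other, in one direction or the other, until one of them is integral;
the two directions are drawn with the probabilities that preserve the expectation. A residual
fractional variable is rounded to `1` with probability its value. -/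
inductive IsDepRound {M : Type*} [DecidableEq M] (s : M → ℝ) : (M → ℝ) → PMF (M → Bool) → Prop
  | done (x : M → Bool) : IsDepRound s (fun m => if x m then 1 else 0) (PMF.pure x)
  | residual (x : M → Bool) (y : M → ℝ) (m : M) (hm : 0 < y m ∧ y m < 1)
      (hx : ∀ m', m' ≠ m → y m' = if x m' then 1 else 0)
      (c : PMF Bool) (hc : (c true).toReal = y m) :
      IsDepRound s y (mixLaw c (PMF.pure (Function.update x m true))
        (PMF.pure (Function.update x m false)))
  | simplify (y : M → ℝ) (m m' : M) (hne : m ≠ m')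
      (hm : 0 < y m ∧ y m < 1) (hm' : 0 < y m' ∧ y m' < 1) (u w : ℝ)
      (hu : u = min (s m * (1 - y m)) (s m' * y m'))
      (hw : w = min (s m * y m) (s m' * (1 - y m')))
      (c : PMF Bool) (hc : (c true).toReal = w / (u + w)) (P Q : PMF (M → Bool))
      (hP : IsDepRound s
        (Function.update (Function.update y m (y m + u / s m)) m' (y m' - u / s m')) P)
      (hQ : IsDepRound s
        (Function.update (Function.update y m (y m - w / s m)) m' (y m' + w / s m')) Q) :
      IsDepRound s y (mixLaw c P Q)
  | random (y : M → ℝ) (c : PMF Bool) (P Q : PMF (M → Bool))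
      (hP : IsDepRound s y P) (hQ : IsDepRound s y Q) : IsDepRound s y (mixLaw c P Q)

namespace InferenceNetwork

variable {V N M Req : Type*} [Fintype V] [DecidableEq V] [DecidableEq N]
  [Fintype M] [DecidableEq M] [Fintype Req] (net : InferenceNetwork V N M Req)

/-- The repository node at the end of the path of a request type. -/
def repoNode (ρ : Req) : V := (net.path ρ).getLast (net.path_ne_nil ρ)

/-- Cost of serving a request of type `ρ` at node `v` of its path with model `m`. -/
def serveCost (ρ : Req) (v : V) (m : M) : ℝ :=
  net.costFn ((net.path ρ).take ((net.path ρ).idxOf v + 1)) m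

/-- The node-model pairs that may serve requests of type `ρ`. -/
abbrev Slot (ρ : Req) := {v // v ∈ net.path ρ} × {m // net.taskOf m = net.task ρ}

/-- Number of node-model pairs that may serve requests of type `ρ`. -/
def numSlots (ρ : Req) : ℕ :=
  (net.path ρ).length * Fintype.card {m // net.taskOf m = net.task ρ}

/-- For every request type, an enumeration of the pairs that may serve it by increasing cost
(ties are broken in any way). Ranks are counted from `0`. -/
structure CostOrder where
  enum : ∀ ρ, Fin (net.numSlots ρ) ≃ net.Slot ρ
  mono : ∀ ρ, Monotone fun k => net.serveCost ρ (enum ρ k).1 (enum ρ k).2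

variable {net}

/-- Rank of the pair `(v, m)` for the request type `ρ`, infinite if it cannot serve it. -/
def rank (ord : net.CostOrder) (ρ : Req) (v : V) (m : M) : ℕ∞ :=
  if h : v ∈ net.path ρ ∧ net.taskOf m = net.task ρ then
    (((ord.enum ρ).symm (⟨v, h.1⟩, ⟨m, h.2⟩) : ℕ) : ℕ∞)
  else ⊤

/-- The serving cost of rank `k`. -/
def rankCost (ord : net.CostOrder) (ρ : Req) (k : ℕ) : ℝ :=
  if h : k < net.numSlots ρ then
    net.serveCost ρ (ord.enum ρ ⟨k, h⟩).1 (ord.enum ρ ⟨k, h⟩).2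
  else 0

/-- Effective available capacity, under the allocation `y`, of the pair of rank `k`. -/
def effCap (ord : net.CostOrder) (l : Req → V → M → ℕ) (y : V → M → ℝ) (ρ : Req) (k : ℕ) : ℝ :=
  if h : k < net.numSlots ρ then
    y (ord.enum ρ ⟨k, h⟩).1 (ord.enum ρ ⟨k, h⟩).2 *
      l ρ (ord.enum ρ ⟨k, h⟩).1 (ord.enum ρ ⟨k, h⟩).2
  else 0

/-- Aggregate cost of a slot: requests are served by increasing cost, up to saturation. -/
def cost (ord : net.CostOrder) (q : Input V M Req) (y : V → M → ℝ) : ℝ :=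
  ∑ ρ, ∑ k ∈ Finset.range (net.numSlots ρ),
    rankCost ord ρ k *
      min ((q.1 ρ : ℝ) - ∑ k' ∈ Finset.range k, effCap ord q.2 y ρ k') (effCap ord q.2 y ρ k) *
      (if ∑ k' ∈ Finset.range k, effCap ord q.2 y ρ k' < (q.1 ρ : ℝ) then 1 else 0)

/-- Allocation gain: cost reduction with respect to the minimal allocation. -/
def gain (ord : net.CostOrder) (q : Input V M Req) (y : V → M → ℝ) : ℝ :=
  cost ord q (toVec net.repo) - cost ord q y

/-- Rank of the worst needed model: the least rank at which the cumulative effective capacity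
reaches the number of requests (the last rank if this does not happen before). -/
def worstNeeded (ord : net.CostOrder) (q : Input V M Req) (y : V → M → ℝ) (ρ : Req) : ℕ :=
  sInf {k | k < net.numSlots ρ ∧
    ((q.1 ρ : ℝ) ≤ ∑ k' ∈ Finset.range (k + 1), effCap ord q.2 y ρ k' ∨ k + 1 = net.numSlots ρ)}

/-- The subgradient of the gain used by the algorithm. -/
def subgrad (ord : net.CostOrder) (q : Input V M Req) (y : V → M → ℝ) (v : V) (m : M) : ℝ :=
  ∑ ρ, (q.2 ρ v m : ℝ) * (rankCost ord ρ (worstNeeded ord q y ρ) - net.serveCost ρ v m) *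
    (if rank ord ρ v m < (worstNeeded ord q y ρ : ℕ∞) then 1 else 0)

variable (net)

/-- Valid integral allocations. -/
def intAlloc : Set (V → M → Bool) :=
  {x | ∀ v, ∑ m, toVec x v m * net.size v m ≤ net.budget v ∧
    ∀ m, toVec net.repo v m ≤ toVec x v m}

/-- Valid fractional allocations at node `v`: they use the whole budget, or are constantly `1` when
the node can store the whole catalog, and contain the repository models. -/
def fracAlloc (v : V) : Set (M → ℝ) :=
  {y | (∀ m, 0 ≤ y m ∧ y m ≤ 1) ∧ (∀ m, toVec net.repo v m ≤ y m) ∧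
    if net.budget v ≤ ∑ m, net.size v m then ∑ m, y m * net.size v m = net.budget v
    else ∀ m, y m = 1}

/-- The open positive orthant, the domain of the mirror map of a node. -/
def posOrthant (M : Type*) : Set (M → ℝ) := {y | ∀ m, 0 < y m}

/-- The inputs among which the adversary chooses. Every repository node of a task can serve all the
requests for this task; the available capacities are at most the number of requests and the maximum
capacities, and the adversary does not control those of the repository models. -/
def adversary : Set (Input V M Req) :=
  {q | (∀ i v, (∃ m, net.taskOf m = i ∧ net.repo v m = true) →
      ∑ ρ with net.task ρ = i, (q.1 ρ : ℝ) ≤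
        ∑ m with net.taskOf m = i, toVec net.repo v m * (net.capacity v m : ℝ)) ∧
    (∀ ρ v m, q.2 ρ v m ≤ min (net.capacity v m) (q.1 ρ)) ∧
    ∀ ρ v m, net.taskOf m = net.task ρ → net.repo v m = true →
      q.2 ρ v m = min (net.capacity v m) (q.1 ρ)}

/-- The weighted negative entropy, mirror map of node `v`. -/
def mirrorMap (v : V) (y : M → ℝ) : ℝ := ∑ m, net.size v m * y m * Real.log (y m)

/-- The gradient of the mirror map of node `v`. -/
def mirrorGrad (v : V) (y : M → ℝ) : M → ℝ := fun m =>
  deriv (fun τ => net.mirrorMap v (Function.update y m τ)) (y m)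

/-- The Bregman divergence of the mirror map of node `v`. -/
def bregman (v : V) (y y' : M → ℝ) : ℝ :=
  net.mirrorMap v y - net.mirrorMap v y' - ∑ m, net.mirrorGrad v y' m * (y m - y' m)

/-- The Bregman projection onto the positive valid fractional allocations at node `v`. -/
def bregmanProj (v : V) (h : M → ℝ) : M → ℝ :=
  argminOn (fun y => net.bregman v y h) (net.fracAlloc v ∩ posOrthant M)

variable {net}

/-- The fractional states of INFIDA with learning rate `η` on the inputs `q 0, q 1, …`
(slots are counted from `0`). -/
def infidaState (ord : net.CostOrder) (η : ℝ) (q : ℕ → Input V M Req) : ℕ → V → M → ℝ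
  | 0 => fun v => argminOn (net.mirrorMap v) (net.fracAlloc v ∩ posOrthant M)
  | t + 1 => fun v =>
      net.bregmanProj v (Function.invFunOn (net.mirrorGrad v) (posOrthant M)
        (net.mirrorGrad v (infidaState ord η q t v) +
          η • subgrad ord (q t) (infidaState ord η q t) v))

/-- Expected total gain of INFIDA over `T` slots: at every slot, every node rounds its fractional
state independently with the procedure `round`. -/
def infidaGain (ord : net.CostOrder) (round : V → (M → ℝ) → PMF (M → Bool)) (η : ℝ) (T : ℕ)
    (q : ℕ → Input V M Req) : ℝ :=
  ∫ x : Fin T → V → M → Bool, ∑ t : Fin T, gain ord (q t) (toVec (x t))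
    ∂(Measure.pi fun t : Fin T => Measure.pi fun v =>
      (round v (infidaState ord η q t v)).toMeasure)

/-- Total gain over `T` slots of the best static integral allocation. -/
def bestStaticGain (ord : net.CostOrder) (T : ℕ) (q : ℕ → Input V M Req) : ℝ :=
  ⨆ x : net.intAlloc, ∑ t : Fin T, gain ord (q t) (toVec x.1)

/-- The `ψ`-regret of INFIDA over `T` slots: the supremum is over all inputs of the adversary in
the slots `0, …, T - 1` (the later values of `q` play no role). -/
def infidaRegret (ord : net.CostOrder) (round : V → (M → ℝ) → PMF (M → Bool)) (η ψ : ℝ)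
    (T : ℕ) : EReal :=
  ⨆ (q : ℕ → Input V M Req) (_ : ∀ t < T, q t ∈ net.adversary),
    ((ψ * bestStaticGain ord T q - infidaGain ord round η T q : ℝ) : EReal)

variable (net)

/-- The largest model size. -/
def sizeMax : ℝ := ⨆ a : V × M, net.size a.1 a.2

/-- The smallest model size. -/
def sizeMin : ℝ := ⨅ a : V × M, net.size a.1 a.2

/-- The bound `∑ᵥ min(bᵛ, ‖sᵛ‖₁) log(‖sᵛ‖₁ / min(bᵛ, ‖sᵛ‖₁))` on the initial Bregman divergence. -/
def divBound : ℝ :=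
  ∑ v, min (net.budget v) (∑ m, net.size v m) *
    Real.log ((∑ m, net.size v m) / min (net.budget v) (∑ m, net.size v m))

/-- The subgradient bound `σ = R L Δ / s_min`. -/
def lipBound (R L : ℕ) (Δ : ℝ) : ℝ := R * L * Δ / net.sizeMin

/-- The strong convexity constant `θ = 1 / (s_max |V| |M|)`. -/
def convexity : ℝ := 1 / (net.sizeMax * Fintype.card V * Fintype.card M)

/-- The learning rate `η = (1 / σ) √(2 θ D_max / T)`. -/
def learningRate (R L : ℕ) (Δ : ℝ) (T : ℕ) : ℝ :=
  1 / net.lipBound R L Δ * √(2 * net.convexity * net.divBound / T)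

/-- The regret constant
`A = (1 - 1/e) (R L Δ / s_min) √(s_max |V| |M|) √(2 D_max)`. -/
def regretConst (R L : ℕ) (Δ : ℝ) : ℝ :=
  (1 - 1 / Real.exp 1) * (R * L * Δ / net.sizeMin) *
    √(net.sizeMax * Fintype.card V * Fintype.card M) * √(2 * net.divBound)

end InferenceNetwork

end

/-!
The regret splits into a deterministic part, for the fractional states `yₜ`, and the loss of rounding.

*Gain.* A repository model of the requested task always has available capacity `r_ρ`, so every
allocation that contains the repository models serves all the requests. Summation by parts
(`cost_eq`, `gain_sub_gain`) then writes the gain as a combination, with the nonnegative coefficients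
`γᵏ⁺¹ - γᵏ`, of the numbers `min(r_ρ, Zᵏ_ρ(y))` of requests served by the first `k` pairs, where
`Zᵏ_ρ` is linear in `y`. Hence the gain is monotone (`gain_mono`), and concave with supergradient
`subgrad` (`gain_sub_gain_le`), whose components lie in `[0, R L Δ]` (`subgrad_bounds`).

*Fractional states.* At each node the states follow mirror descent for the weighted entropy. The
Bregman projections exist with positive components (`exists_isMinOn_tilted`) and satisfy the
first-order condition against all of `fracAlloc` (`first_order_optimality`). With the three-point
identity and the strong convexity of the entropy this gives `mirror_step`; summing over nodes and
slots, with `divBound` as bound on the initial divergence (`bregman_init_le`), gives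
`infidaState_linear_regret`, and the learning rate balances its two terms
(`le_of_balanced_rate`). Strong convexity is applied coordinatewise; the bound obtained is at most the
one in terms of `σ` and `θ` (`sum_sq_div_size_le`). An integral comparator `x` is first enlarged to a
fractional allocation that uses the budgets (`exists_fracAlloc_ge`).

*Rounding.* The output of DepRound is negatively correlated: `E ∏ (1 - cₘ xₘ) ≤ ∏ (1 - cₘ yₘ)` for
`cₘ ∈ [0, 1]` (`IsDepRound.expect_prod_le`), and nodes are independent. As
`min(1, ∑ aᵢ) ≥ 1 - ∏ (1 - aᵢ) ≥ (1 - 1/e) min(1, ∑ aᵢ)` on `[0, 1]`, rounding keeps the fraction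
`1 - 1/e` of each `min(r_ρ, Zᵏ_ρ)` in expectation (`integral_min_depRound_ge`). In the gain these
terms are offset by their values at the minimal allocation, which are `0` or `r_ρ`; in the second case
nothing is lost (`integral_served_ge`). This gives `E G(xₜ) ≥ (1 - 1/e) G(yₜ)` (`integral_gain_ge`).
-/

open MeasureTheory

noncomputable section

set_option linter.unusedSectionVars false

/-! ### Elementary inequalities -/

/-- The first-order remainder of `b ↦ b log b` on `(0, 1]` dominates that of `b ↦ b² / 2`, since the
second derivative `1 / b` is at least `1` there. -/
theorem sq_sub_div_two_le_entropy_remainder {a b : ℝ} (ha : 0 < a) (ha1 : a ≤ 1) (hb : 0 < b)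
    (hb1 : b ≤ 1) :
    (b - a) ^ 2 / 2 ≤ b * Real.log b - b * Real.log a - b + a := by
  rcases le_total b a with hba | hab
  · -- with `b = a e⁻ˣ`, this is `x ≤ sinh x`
    have hx : 0 ≤ Real.log a - Real.log b := sub_nonneg.2 (Real.log_le_log hb hba)
    have h := Real.self_le_sinh_iff.2 hx
    rw [Real.sinh_eq, Real.exp_sub, neg_sub, Real.exp_sub, Real.exp_log ha, Real.exp_log hb] at h
    have h1 : b * (Real.log a - Real.log b) ≤ b * ((a / b - b / a) / 2) :=
      mul_le_mul_of_nonneg_left h hb.le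
    have h2 : b * ((a / b - b / a) / 2) = (a - b ^ 2 / a) / 2 := by field_simp
    have h3 : (b - a) ^ 2 ≤ (b - a) ^ 2 / a := by
      rw [le_div_iff₀ ha]; nlinarith [sq_nonneg (b - a)]
    have h4 : (b - a) ^ 2 / a = b ^ 2 / a - 2 * b + a := by field_simp; ring
    linarith
  · -- with `t = (b - a) / b`, this follows from `t + t² / 2 ≤ -log (1 - t)`
    have ht0 : 0 ≤ (b - a) / b := div_nonneg (sub_nonneg.2 hab) hb.le
    have ht1 : (b - a) / b < 1 := by rw [div_lt_one hb]; linarith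
    have hs := Real.hasSum_pow_div_log_of_abs_lt_one (abs_lt.2 ⟨by linarith, ht1⟩)
    have h := sum_le_hasSum (Finset.range 2) (fun i _ => by positivity) hs
    have h1 : 1 - (b - a) / b = a / b := by field_simp; ring
    rw [h1, Real.log_div ha.ne' hb.ne'] at h
    norm_num [Finset.sum_range_succ] at h
    have h2 := mul_le_mul_of_nonneg_left h hb.le
    have h3 : b * ((b - a) / b + ((b - a) / b) ^ 2 / 2) = b - a + (b - a) ^ 2 / b / 2 := by
      field_simp
    have h4 : (b - a) ^ 2 ≤ (b - a) ^ 2 / b := by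
      rw [le_div_iff₀ hb]; nlinarith [sq_nonneg (b - a)]
    linarith

/-- Weierstrass' product inequality. -/
theorem one_sub_prod_one_sub_le_sum {ι : Type*} (s : Finset ι) (a : ι → ℝ)
    (ha : ∀ i, 0 ≤ a i ∧ a i ≤ 1) : 1 - ∏ i ∈ s, (1 - a i) ≤ ∑ i ∈ s, a i := by
  classical
  induction s using Finset.induction_on with
  | empty => simp
  | insert i s hi ih =>
    rw [Finset.prod_insert hi, Finset.sum_insert hi]
    have h0 : 0 ≤ ∏ j ∈ s, (1 - a j) := Finset.prod_nonneg fun j _ => by linarith [ha j]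
    have h1 : ∏ j ∈ s, (1 - a j) ≤ 1 :=
      Finset.prod_le_one (fun j _ => by linarith [ha j]) fun j _ => by linarith [ha j]
    nlinarith [ha i]

/-- The concave function `t ↦ 1 - e⁻ᵗ` lies above its chord on `[0, 1]` and is increasing. -/
theorem chord_mul_min_le_one_sub_exp_neg {t : ℝ} (ht : 0 ≤ t) :
    (1 - 1 / Real.exp 1) * min 1 t ≤ 1 - Real.exp (-t) := by
  have key : ∀ s : ℝ, 0 ≤ s → s ≤ 1 → (1 - 1 / Real.exp 1) * s ≤ 1 - Real.exp (-s) := by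
    intro s hs0 hs1
    have h := convexOn_exp.2 (Set.mem_univ (0 : ℝ)) (Set.mem_univ (-1 : ℝ))
      (show 0 ≤ 1 - s by linarith) hs0 (by ring)
    simp only [smul_eq_mul, mul_zero, zero_add, Real.exp_zero, mul_neg, mul_one] at h
    rw [Real.exp_neg 1] at h
    rw [one_div]
    linarith
  rcases le_total t 1 with h | h
  · rw [min_eq_right h]; exact key t ht h
  · rw [min_eq_left h]
    have h1 := key 1 zero_le_one le_rfl
    have h2 : Real.exp (-t) ≤ Real.exp (-1) := Real.exp_le_exp.2 (by linarith)
    linarith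

theorem chord_mul_min_le_one_sub_prod {ι : Type*} (s : Finset ι) (a : ι → ℝ)
    (ha : ∀ i, 0 ≤ a i ∧ a i ≤ 1) :
    (1 - 1 / Real.exp 1) * min 1 (∑ i ∈ s, a i) ≤ 1 - ∏ i ∈ s, (1 - a i) := by
  refine (chord_mul_min_le_one_sub_exp_neg (Finset.sum_nonneg fun i _ => (ha i).1)).trans ?_
  rw [← Finset.sum_neg_distrib, Real.exp_sum]
  have : ∏ i ∈ s, (1 - a i) ≤ ∏ i ∈ s, Real.exp (-a i) :=
    Finset.prod_le_prod (fun i _ => by linarith [ha i]) fun i _ => Real.one_sub_le_exp_neg _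
  linarith

/-- A batch served one pair after the other, up to saturation. -/
theorem saturated_service (r Z z : ℝ) (hz : 0 ≤ z) :
    min (r - Z) z * (if Z < r then 1 else 0) = min r (Z + z) - min r Z := by
  split_ifs with h
  · rw [min_eq_right h.le, ← min_sub_sub_right, mul_one, add_sub_cancel_left]
  · rw [min_eq_left (not_lt.1 h), min_eq_left (by linarith [not_lt.1 h] : r ≤ Z + z),
      mul_zero, sub_self]

/-! ### Dependent rounding -/

/-- Expectation of `f` under a law on a finite type. -/
def expect {α : Type*} [Fintype α] (P : PMF α) (f : α → ℝ) : ℝ := ∑ x, (P x).toReal * f x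

theorem expect_pure {α : Type*} [Fintype α] (a : α) (f : α → ℝ) :
    expect (PMF.pure a) f = f a := by
  classical
  unfold expect
  rw [Finset.sum_eq_single a]
  · simp
  · intro b _ hb; simp [PMF.pure_apply, hb]
  · simp

theorem coin_false (c : PMF Bool) : (c false).toReal = 1 - (c true).toReal := by
  have h := c.tsum_coe
  rw [tsum_bool] at h
  have h2 := congrArg ENNReal.toReal h
  rw [ENNReal.toReal_add (c.apply_ne_top _) (c.apply_ne_top _)] at h2
  simp at h2; linarith

theorem expect_mixLaw {α : Type*} [Fintype α] (c : PMF Bool) (P Q : PMF α) (f : α → ℝ) :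
    expect (mixLaw c P Q) f =
      (c true).toReal * expect P f + (1 - (c true).toReal) * expect Q f := by
  unfold expect mixLaw
  rw [Finset.mul_sum, Finset.mul_sum, ← Finset.sum_add_distrib]
  refine Finset.sum_congr rfl fun x _ => ?_
  rw [PMF.bind_apply, tsum_bool, ENNReal.toReal_add
    (ENNReal.mul_ne_top (c.apply_ne_top _) (PMF.apply_ne_top _ _))
    (ENNReal.mul_ne_top (c.apply_ne_top _) (PMF.apply_ne_top _ _)), ENNReal.toReal_mul,
    ENNReal.toReal_mul, coin_false]
  simp only [Bool.false_eq_true, if_false, if_true]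
  ring

theorem prod_update_update {M : Type*} [Fintype M] [DecidableEq M] (y c : M → ℝ) {m m' : M}
    (hne : m ≠ m') (a b : ℝ) :
    ∏ k, (1 - c k * Function.update (Function.update y m a) m' b k) =
      (1 - c m * a) * (1 - c m' * b) *
        ∏ k ∈ (Finset.univ.erase m).erase m', (1 - c k * y k) := by
  rw [← Finset.mul_prod_erase _ _ (Finset.mem_univ m),
    ← Finset.mul_prod_erase (Finset.univ.erase m) _
      (Finset.mem_erase.2 ⟨hne.symm, Finset.mem_univ m'⟩), ← mul_assoc]
  congr 1
  · simp [hne]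
  · refine Finset.prod_congr rfl fun k hk => ?_
    simp only [Finset.mem_erase, Finset.mem_univ, and_true] at hk
    simp [hk.1, hk.2]

/-- DepRound output is negatively correlated: every simplification step moves the two variables in
opposite directions and keeps their expectations, so it does not increase the expectation of the
product. -/
theorem IsDepRound.expect_prod_le {M : Type*} [Fintype M] [DecidableEq M] {s : M → ℝ}
    (hs : ∀ m, 0 < s m) {c : M → ℝ} (hc : ∀ m, 0 ≤ c m ∧ c m ≤ 1) {y : M → ℝ}
    {P : PMF (M → Bool)} (h : IsDepRound s y P) (hy : ∀ m, 0 ≤ y m ∧ y m ≤ 1) :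
    expect P (fun x => ∏ m, (1 - c m * if x m then 1 else 0)) ≤ ∏ m, (1 - c m * y m) := by
  induction h with
  | done x => rw [expect_pure]
  | residual x y m hm hx d hd =>
    rw [expect_mixLaw, expect_pure, expect_pure, hd]
    have e : ∀ b : Bool, ∏ k, (1 - c k * if Function.update x m b k then 1 else 0) =
        (1 - c m * if b then 1 else 0) * ∏ k ∈ Finset.univ.erase m, (1 - c k * y k) := by
      intro b
      rw [← Finset.mul_prod_erase _ _ (Finset.mem_univ m)]
      congr 1
      · simp
      · refine Finset.prod_congr rfl fun k hk => ?_
        have hk' := Finset.ne_of_mem_erase hk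
        rw [hx k hk', Function.update_of_ne hk']
    rw [e, e, ← Finset.mul_prod_erase _ _ (Finset.mem_univ m)]
    refine le_of_eq ?_
    simp only [Bool.false_eq_true, if_false, if_true]
    ring
  | simplify y m m' hne hm hm' u w hu hw d hd P Q hP hQ ihP ihQ =>
    have hsm := hs m
    have hsm' := hs m'
    have hu0 : 0 < u := hu ▸ lt_min (mul_pos hsm (by linarith)) (mul_pos hsm' (by linarith))
    have hw0 : 0 < w := hw ▸ lt_min (mul_pos hsm (by linarith)) (mul_pos hsm' (by linarith))
    have hu1 : u / s m ≤ 1 - y m := by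
      rw [div_le_iff₀ hsm, hu, mul_comm]; exact min_le_left _ _
    have hu2 : u / s m' ≤ y m' := by
      rw [div_le_iff₀ hsm', hu, mul_comm (y m')]; exact min_le_right _ _
    have hw1 : w / s m ≤ y m := by
      rw [div_le_iff₀ hsm, hw, mul_comm (y m)]; exact min_le_left _ _
    have hw2 : w / s m' ≤ 1 - y m' := by
      rw [div_le_iff₀ hsm', hw, mul_comm (1 - y m')]; exact min_le_right _ _
    have p1 : 0 < u / s m := by positivity
    have p2 : 0 < u / s m' := by positivity
    have p3 : 0 < w / s m := by positivity
    have p4 : 0 < w / s m' := by positivity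
    have upd : ∀ a b : ℝ, (0 ≤ a ∧ a ≤ 1) → (0 ≤ b ∧ b ≤ 1) → ∀ k,
        0 ≤ Function.update (Function.update y m a) m' b k ∧
          Function.update (Function.update y m a) m' b k ≤ 1 := by
      intro a b ha hb k
      by_cases h1 : k = m'
      · subst h1; simpa using hb
      · by_cases h2 : k = m
        · subst h2; simpa [h1] using ha
        · simpa [h1, h2] using hy k
    have iP := ihP (upd _ _ ⟨by linarith, by linarith⟩ ⟨by linarith, by linarith⟩)
    have iQ := ihQ (upd _ _ ⟨by linarith, by linarith⟩ ⟨by linarith, by linarith⟩)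
    rw [prod_update_update y c hne] at iP iQ
    set E := ∏ k ∈ (Finset.univ.erase m).erase m', (1 - c k * y k) with hE
    have hE0 : 0 ≤ E := Finset.prod_nonneg fun k _ => by nlinarith [hc k, hy k]
    have ey : ∏ k, (1 - c k * y k) = (1 - c m * y m) * (1 - c m' * y m') * E := by
      have := prod_update_update y c hne (y m) (y m')
      simpa [Function.update_eq_self] using this
    have huw : 0 < u + w := by linarith
    have hd' : 1 - (d true).toReal = u / (u + w) := by rw [hd]; field_simp; ring
    rw [expect_mixLaw, hd', hd, ey]
    have q1 : 0 ≤ w / (u + w) := by positivity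
    have q2 : 0 ≤ u / (u + w) := by positivity
    refine (add_le_add (mul_le_mul_of_nonneg_left iP q1)
      (mul_le_mul_of_nonneg_left iQ q2)).trans ?_
    -- the first-order terms cancel and the second-order term is `-cₘ cₘ' u w / (sₘ sₘ')`
    have id1 : w / (u + w) * ((1 - c m * (y m + u / s m)) * (1 - c m' * (y m' - u / s m')) * E) +
        u / (u + w) * ((1 - c m * (y m - w / s m)) * (1 - c m' * (y m' + w / s m')) * E) =
        (1 - c m * y m) * (1 - c m' * y m') * E - c m * c m' * (u * w / (s m * s m')) * E := by
      field_simp; ring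
    rw [id1]
    have : 0 ≤ c m * c m' * (u * w / (s m * s m')) * E :=
      mul_nonneg (mul_nonneg (mul_nonneg (hc m).1 (hc m').1) (by positivity)) hE0
    linarith
  | random y d P Q hP hQ ihP ihQ =>
    rw [expect_mixLaw]
    have h1 : (d true).toReal ≤ 1 := by
      rw [← ENNReal.toReal_one]
      exact ENNReal.toReal_mono ENNReal.one_ne_top (d.coe_le_one true)
    nlinarith [ihP hy, ihQ hy, ENNReal.toReal_nonneg (a := d true)]

/-- Nodes are rounded independently, so the negative correlation extends to the whole network. -/
theorem integral_prod_depRound_le {V M : Type*} [Fintype V] [Fintype M] [DecidableEq M]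
    {s : V → M → ℝ} (hs : ∀ v m, 0 < s v m) {c : V → M → ℝ} (hc : ∀ v m, 0 ≤ c v m ∧ c v m ≤ 1)
    {y : V → M → ℝ} (hy : ∀ v m, 0 ≤ y v m ∧ y v m ≤ 1) {P : V → PMF (M → Bool)}
    (hP : ∀ v, IsDepRound (s v) (y v) (P v)) :
    ∫ x, (∏ v, ∏ m, (1 - c v m * toVec x v m)) ∂(Measure.pi fun v => (P v).toMeasure) ≤
      ∏ v, ∏ m, (1 - c v m * y v m) := by
  unfold toVec
  rw [integral_fintype_prod_eq_prod (𝕜 := ℝ)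
    (fun v (x : M → Bool) => ∏ m, (1 - c v m * if x m then 1 else 0))]
  have e : ∀ v, ∫ x, (∏ m, (1 - c v m * if x m then 1 else 0)) ∂((P v).toMeasure) =
      expect (P v) (fun x => ∏ m, (1 - c v m * if x m then 1 else 0)) := fun v => by
    rw [PMF.integral_eq_sum]; rfl
  refine Finset.prod_le_prod (fun v _ => integral_nonneg fun x => Finset.prod_nonneg fun m _ => ?_)
    fun v _ => (e v).trans_le ((hP v).expect_prod_le (hs v) (hc v) (hy v))
  split_ifs <;> simp [hc v m]

/-- Rounding independently with DepRound loses at most a factor `1 - 1/e` in the expected number of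
requests served by capacities `w` that do not exceed the number `r` of requests, and loses nothing
if one deployed model has capacity `r`. -/
theorem integral_min_depRound_ge {V M : Type*} [Fintype V] [Fintype M] [DecidableEq M]
    {s : V → M → ℝ} (hs : ∀ v m, 0 < s v m) {r : ℝ} (hr : 0 < r) {w : V → M → ℝ}
    (hw : ∀ v m, 0 ≤ w v m ∧ w v m ≤ r) {y : V → M → ℝ} (hy : ∀ v m, 0 ≤ y v m ∧ y v m ≤ 1)
    {P : V → PMF (M → Bool)} (hP : ∀ v, IsDepRound (s v) (y v) (P v)) :
    (1 - 1 / Real.exp 1) * min r (∑ v, ∑ m, w v m * y v m) ≤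
      ∫ x, min r (∑ v, ∑ m, w v m * toVec x v m) ∂(Measure.pi fun v => (P v).toMeasure) ∧
    ((∃ v m, w v m = r ∧ y v m = 1) →
      r ≤ ∫ x, min r (∑ v, ∑ m, w v m * toVec x v m) ∂(Measure.pi fun v => (P v).toMeasure)) := by
  have hc : ∀ v m, 0 ≤ w v m / r ∧ w v m / r ≤ 1 := fun v m =>
    ⟨div_nonneg (hw v m).1 hr.le, (div_le_one hr).2 (hw v m).2⟩
  have hint := integral_prod_depRound_le hs hc hy hP
  have hsum : ∀ z : V → M → ℝ, ∑ v, ∑ m, w v m * z v m =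
      r * ∑ a : V × M, w a.1 a.2 / r * z a.1 a.2 := by
    intro z
    rw [Fintype.sum_prod_type, Finset.mul_sum]
    refine Finset.sum_congr rfl fun v _ => ?_
    rw [Finset.mul_sum]
    refine Finset.sum_congr rfl fun m _ => ?_
    field_simp
  have hmin : ∀ t : ℝ, min r (r * t) = r * min 1 t := fun t => by
    rw [mul_min_of_nonneg _ _ hr.le, mul_one]
  have hprod : ∀ z : V → M → ℝ, ∏ v, ∏ m, (1 - w v m / r * z v m) =
      ∏ a : V × M, (1 - w a.1 a.2 / r * z a.1 a.2) := fun z => by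
    rw [Fintype.prod_prod_type]
  have hlow : r * (1 - ∏ v, ∏ m, (1 - w v m / r * y v m)) ≤
      ∫ x, min r (∑ v, ∑ m, w v m * toVec x v m) ∂(Measure.pi fun v => (P v).toMeasure) := by
    have h1 : ∫ x, r * (1 - ∏ v, ∏ m, (1 - w v m / r * toVec x v m))
        ∂(Measure.pi fun v => (P v).toMeasure) ≤
        ∫ x, min r (∑ v, ∑ m, w v m * toVec x v m) ∂(Measure.pi fun v => (P v).toMeasure) := by
      refine integral_mono .of_finite .of_finite fun x => ?_
      have hx : ∀ v m, 0 ≤ toVec x v m ∧ toVec x v m ≤ 1 := fun v m => by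
        unfold toVec; split_ifs <;> simp
      have ha : ∀ a : V × M, 0 ≤ w a.1 a.2 / r * toVec x a.1 a.2 ∧
          w a.1 a.2 / r * toVec x a.1 a.2 ≤ 1 := fun a =>
        ⟨mul_nonneg (hc _ _).1 (hx _ _).1, mul_le_one₀ (hc _ _).2 (hx _ _).1 (hx _ _).2⟩
      simp only
      rw [hprod, hsum, hmin]
      refine mul_le_mul_of_nonneg_left (le_min ?_ ?_) hr.le
      · have : 0 ≤ ∏ a : V × M, (1 - w a.1 a.2 / r * toVec x a.1 a.2) :=
          Finset.prod_nonneg fun a _ => by linarith [ha a]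
        linarith
      · exact one_sub_prod_one_sub_le_sum _ _ ha
    rw [integral_const_mul, integral_sub .of_finite .of_finite] at h1
    simp only [integral_const, probReal_univ, smul_eq_mul, one_mul] at h1
    exact (mul_le_mul_of_nonneg_left (by linarith) hr.le).trans h1
  refine ⟨le_trans ?_ hlow, ?_⟩
  · rw [hsum, hmin, hprod, mul_left_comm]
    refine mul_le_mul_of_nonneg_left (chord_mul_min_le_one_sub_prod _ _ fun a => ?_) hr.le
    exact ⟨mul_nonneg (hc _ _).1 (hy _ _).1, mul_le_one₀ (hc _ _).2 (hy _ _).1 (hy _ _).2⟩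
  · rintro ⟨v, m, hwr, hy1⟩
    refine le_trans (le_of_eq ?_) hlow
    have : ∏ v, ∏ m, (1 - w v m / r * y v m) = 0 :=
      Finset.prod_eq_zero (Finset.mem_univ v) (Finset.prod_eq_zero (Finset.mem_univ m)
        (by rw [hwr, hy1, div_self hr.ne']; norm_num))
    rw [this]; ring

namespace InferenceNetwork

/-! ### Served requests and the gain -/

variable {V N M Req : Type*} [Fintype V] [DecidableEq V] [DecidableEq N]
  [Fintype M] [DecidableEq M] [Fintype Req] {net : InferenceNetwork V N M Req}

/-- Cumulative effective capacity, under the allocation `y`, of the first `k` pairs for `ρ`. -/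
def cumCap (ord : net.CostOrder) (q : Input V M Req) (y : V → M → ℝ) (ρ : Req) (k : ℕ) : ℝ :=
  ∑ k' ∈ Finset.range k, effCap ord q.2 y ρ k'

/-- Number of requests of type `ρ` served by the first `k` pairs under the allocation `y`. -/
def served (ord : net.CostOrder) (q : Input V M Req) (y : V → M → ℝ) (ρ : Req) (k : ℕ) : ℝ :=
  min (q.1 ρ : ℝ) (cumCap ord q y ρ k)

/-- Potential capacity of `(v, m)` for `ρ`, cut to the pairs of the first `k` ranks. -/
def rankCap (ord : net.CostOrder) (q : Input V M Req) (ρ : Req) (k : ℕ) (v : V) (m : M) : ℝ :=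
  if rank ord ρ v m < (k : ℕ∞) then (q.2 ρ v m : ℝ) else 0

variable (net) in
/-- Fractional allocations that contain the repository models, with no condition on budgets. -/
def coverAlloc : Set (V → M → ℝ) :=
  {y | ∀ v m, 0 ≤ y v m ∧ y v m ≤ 1 ∧ toVec net.repo v m ≤ y v m}

theorem rank_enum (ord : net.CostOrder) (ρ : Req) (j : Fin (net.numSlots ρ)) :
    rank ord ρ (ord.enum ρ j).1 (ord.enum ρ j).2 = ((j : ℕ) : ℕ∞) := by
  unfold rank
  rw [dif_pos ⟨(ord.enum ρ j).1.2, (ord.enum ρ j).2.2⟩]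
  simp

theorem exists_enum_of_rank_lt (ord : net.CostOrder) {ρ : Req} {v : V} {m : M} {k : ℕ}
    (h : rank ord ρ v m < (k : ℕ∞)) :
    ∃ j : Fin (net.numSlots ρ), (j : ℕ) < k ∧ (ord.enum ρ j).1.1 = v ∧ (ord.enum ρ j).2.1 = m := by
  unfold rank at h
  split_ifs at h with hs
  · exact ⟨_, by exact_mod_cast h, by simp, by simp⟩
  · exact absurd h (by simp)

theorem exists_enum_eq (ord : net.CostOrder) {ρ : Req} {v : V} {m : M} (hv : v ∈ net.path ρ)
    (hm : net.taskOf m = net.task ρ) :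
    ∃ j : Fin (net.numSlots ρ), (ord.enum ρ j).1.1 = v ∧ (ord.enum ρ j).2.1 = m :=
  ⟨(ord.enum ρ).symm (⟨v, hv⟩, ⟨m, hm⟩), by simp, by simp⟩

/-- Summation over the pairs of rank less than `k`, by node and model or by rank. -/
theorem sum_rank_lt (ord : net.CostOrder) (ρ : Req) (F : V → M → ℝ) {k : ℕ}
    (hk : k ≤ net.numSlots ρ) :
    ∑ v, ∑ m, (if rank ord ρ v m < (k : ℕ∞) then F v m else 0) =
      ∑ k' ∈ Finset.range k, if h : k' < net.numSlots ρ then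
        F (ord.enum ρ ⟨k', h⟩).1 (ord.enum ρ ⟨k', h⟩).2 else 0 := by
  set G : ℕ → ℝ := fun n => if n < k then (if h : n < net.numSlots ρ then
    F (ord.enum ρ ⟨n, h⟩).1 (ord.enum ρ ⟨n, h⟩).2 else 0) else 0 with hG
  rw [← Fintype.sum_prod_type'
    (f := fun v m => if rank ord ρ v m < (k : ℕ∞) then F v m else 0)]
  have h1 : ∑ j : Fin (net.numSlots ρ), G j =
      ∑ a : V × M, if rank ord ρ a.1 a.2 < (k : ℕ∞) then F a.1 a.2 else 0 := by
    refine Fintype.sum_of_injective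
      (fun j => ((ord.enum ρ j).1.1, (ord.enum ρ j).2.1)) ?_ _ _ ?_ ?_
    · intro i j hij
      simp only [Prod.mk.injEq] at hij
      exact (ord.enum ρ).injective (Prod.ext (Subtype.ext hij.1) (Subtype.ext hij.2))
    · intro a ha
      refine if_neg fun hlt => ha ?_
      obtain ⟨j, -, hj1, hj2⟩ := exists_enum_of_rank_lt ord hlt
      exact ⟨j, Prod.ext hj1 hj2⟩
    · intro j
      simp only [hG, rank_enum, Nat.cast_lt, Fin.is_lt, dite_true, Fin.eta]
  rw [← h1, Fin.sum_univ_eq_sum_range G, ← Finset.sum_subset (Finset.range_mono hk)]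
  · exact Finset.sum_congr rfl fun n hn => if_pos (Finset.mem_range.1 hn)
  · exact fun n _ hn => if_neg fun h => hn (Finset.mem_range.2 h)

theorem cumCap_eq_sum_rankCap (ord : net.CostOrder) (q : Input V M Req) (y : V → M → ℝ) (ρ : Req)
    {k : ℕ} (hk : k ≤ net.numSlots ρ) :
    cumCap ord q y ρ k = ∑ v, ∑ m, rankCap ord q ρ k v m * y v m := by
  unfold cumCap effCap rankCap
  simp only [ite_mul, zero_mul]
  rw [sum_rank_lt ord ρ (fun v m => (q.2 ρ v m : ℝ) * y v m) hk]
  refine Finset.sum_congr rfl fun k' _ => ?_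
  split_ifs
  · exact mul_comm _ _
  · rfl

theorem effCap_mono (ord : net.CostOrder) (q : Input V M Req) {x y : V → M → ℝ}
    (h : ∀ v m, x v m ≤ y v m) (ρ : Req) (k : ℕ) :
    effCap ord q.2 x ρ k ≤ effCap ord q.2 y ρ k := by
  unfold effCap
  split_ifs
  · exact mul_le_mul_of_nonneg_right (h _ _) (Nat.cast_nonneg _)
  · rfl

theorem effCap_nonneg (ord : net.CostOrder) (q : Input V M Req) {y : V → M → ℝ}
    (hy : ∀ v m, 0 ≤ y v m) (ρ : Req) (k : ℕ) : 0 ≤ effCap ord q.2 y ρ k := by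
  unfold effCap
  split_ifs
  · exact mul_nonneg (hy _ _) (Nat.cast_nonneg _)
  · rfl

theorem cumCap_mono (ord : net.CostOrder) (q : Input V M Req) {y : V → M → ℝ}
    (hy : ∀ v m, 0 ≤ y v m) (ρ : Req) : Monotone (cumCap ord q y ρ) :=
  monotone_nat_of_le_succ fun k => by
    unfold cumCap
    rw [Finset.sum_range_succ]
    linarith [effCap_nonneg ord q hy ρ k]

theorem rankCost_mono (ord : net.CostOrder) (ρ : Req) {i j : ℕ} (hij : i ≤ j)
    (hj : j < net.numSlots ρ) : rankCost ord ρ i ≤ rankCost ord ρ j := by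
  unfold rankCost
  rw [dif_pos hj, dif_pos (hij.trans_lt hj)]
  exact ord.mono ρ (Fin.mk_le_mk.2 hij)

theorem numSlots_pos (ord : net.CostOrder) (ρ : Req) : 0 < net.numSlots ρ := by
  obtain ⟨m, hm, -⟩ := net.repo_end ρ
  obtain ⟨j, -⟩ := exists_enum_eq ord (List.getLast_mem (net.path_ne_nil ρ)) hm
  exact j.pos

/-- Summation by parts. -/
theorem sum_mul_increments (γ a : ℕ → ℝ) (n : ℕ) :
    ∑ k ∈ Finset.range (n + 1), γ k * (a (k + 1) - a k) =
      γ n * a (n + 1) - γ 0 * a 0 - ∑ k ∈ Finset.range n, (γ (k + 1) - γ k) * a (k + 1) := by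
  induction n with
  | zero => simp; ring
  | succ n ih => rw [Finset.sum_range_succ, ih, Finset.sum_range_succ _ n]; ring

/-- The cost in terms of the numbers of served requests, weighted by the cost increments. -/
theorem cost_eq (ord : net.CostOrder) (q : Input V M Req) {y : V → M → ℝ}
    (hy : ∀ v m, 0 ≤ y v m) :
    cost ord q y = ∑ ρ, (rankCost ord ρ (net.numSlots ρ - 1) * served ord q y ρ (net.numSlots ρ) -
      ∑ k ∈ Finset.range (net.numSlots ρ - 1),
        (rankCost ord ρ (k + 1) - rankCost ord ρ k) * served ord q y ρ (k + 1)) := by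
  unfold cost
  refine Finset.sum_congr rfl fun ρ _ => ?_
  have h1 : ∀ k, rankCost ord ρ k *
      min ((q.1 ρ : ℝ) - ∑ k' ∈ Finset.range k, effCap ord q.2 y ρ k') (effCap ord q.2 y ρ k) *
      (if ∑ k' ∈ Finset.range k, effCap ord q.2 y ρ k' < (q.1 ρ : ℝ) then 1 else 0) =
      rankCost ord ρ k * (served ord q y ρ (k + 1) - served ord q y ρ k) := by
    intro k
    rw [mul_assoc, saturated_service _ _ _ (effCap_nonneg ord q hy ρ k)]
    unfold served cumCap
    rw [Finset.sum_range_succ]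
  simp only [h1]
  have h0 : served ord q y ρ 0 = 0 := by simp [served, cumCap]
  obtain ⟨n, hn⟩ := Nat.exists_eq_succ_of_ne_zero (numSlots_pos ord ρ).ne'
  rw [hn, Nat.succ_eq_add_one, sum_mul_increments, h0, Nat.add_sub_cancel]
  ring

/-- The adversary cannot saturate a repository model. -/
theorem repo_capacity {q : Input V M Req} (hq : q ∈ net.adversary) {ρ : Req} {v : V} {m : M}
    (hm : net.taskOf m = net.task ρ) (hrepo : net.repo v m = true) : q.2 ρ v m = q.1 ρ := by
  obtain ⟨h1, -, h3⟩ := hq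
  rw [h3 ρ v m hm hrepo]
  refine min_eq_right ?_
  have h := h1 (net.task ρ) v ⟨m, hm, hrepo⟩
  rw [Finset.sum_eq_single m] at h
  · have h4 : (q.1 ρ : ℝ) ≤ ∑ ρ' with net.task ρ' = net.task ρ, (q.1 ρ' : ℝ) :=
      Finset.single_le_sum (f := fun ρ' => (q.1 ρ' : ℝ)) (fun _ _ => Nat.cast_nonneg _)
        (Finset.mem_filter.2 ⟨Finset.mem_univ _, rfl⟩)
    simp only [toVec, hrepo, if_true, one_mul] at h
    exact_mod_cast h4.trans h
  · intro m' hm' hne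
    have : net.repo v m' ≠ true := fun hr =>
      hne (net.repo_unique v m' m ((Finset.mem_filter.1 hm').2.trans hm.symm) hr hrepo)
    simp [toVec, this]
  · exact fun h => absurd (Finset.mem_filter.2 ⟨Finset.mem_univ m, hm⟩) h

theorem avail_le_requests {q : Input V M Req} (hq : q ∈ net.adversary) (ρ : Req) (v : V) (m : M) :
    (q.2 ρ v m : ℝ) ≤ q.1 ρ := by
  exact_mod_cast (hq.2.1 ρ v m).trans (min_le_right _ _)

theorem rankCap_nonneg (ord : net.CostOrder) (q : Input V M Req) (ρ : Req) (k : ℕ) (v : V) (m : M) :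
    0 ≤ rankCap ord q ρ k v m := by
  unfold rankCap; split_ifs <;> simp

theorem rankCap_le (ord : net.CostOrder) {q : Input V M Req} (hq : q ∈ net.adversary) (ρ : Req)
    (k : ℕ) (v : V) (m : M) : rankCap ord q ρ k v m ≤ q.1 ρ := by
  unfold rankCap
  split_ifs
  · exact avail_le_requests hq ρ v m
  · exact Nat.cast_nonneg _

theorem coverAlloc_eq_one {y : V → M → ℝ} (hy : y ∈ net.coverAlloc) {v : V} {m : M}
    (h : net.repo v m = true) : y v m = 1 := by
  have := (hy v m).2
  simp only [toVec, h, if_true] at this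
  exact le_antisymm this.1 this.2

theorem repo_mem_coverAlloc : toVec net.repo ∈ net.coverAlloc := fun v m => by
  unfold toVec; split_ifs <;> simp

/-- A repository model of the requested task serves all the requests. -/
theorem requests_le_cumCap (ord : net.CostOrder) {q : Input V M Req} (hq : q ∈ net.adversary)
    {y : V → M → ℝ} (hy : y ∈ net.coverAlloc) {ρ : Req} {j : Fin (net.numSlots ρ)}
    (hj : net.repo (ord.enum ρ j).1 (ord.enum ρ j).2 = true) {k : ℕ} (hk : (j : ℕ) < k) :
    (q.1 ρ : ℝ) ≤ cumCap ord q y ρ k := by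
  have h1 : effCap ord q.2 y ρ j = q.1 ρ := by
    unfold effCap
    rw [dif_pos j.2]
    simp only [Fin.eta]
    rw [coverAlloc_eq_one hy hj, repo_capacity hq (ord.enum ρ j).2.2 hj, one_mul]
  rw [← h1]
  exact Finset.single_le_sum (f := effCap ord q.2 y ρ)
    (fun i _ => effCap_nonneg ord q (fun v m => (hy v m).1) ρ i) (Finset.mem_range.2 hk)

theorem exists_repo_slot (ord : net.CostOrder) (ρ : Req) :
    ∃ j : Fin (net.numSlots ρ), net.repo (ord.enum ρ j).1 (ord.enum ρ j).2 = true ∧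
      (ord.enum ρ j).1.1 = net.repoNode ρ := by
  obtain ⟨m, hm, hr⟩ := net.repo_end ρ
  obtain ⟨j, h1, h2⟩ := exists_enum_eq ord (List.getLast_mem (net.path_ne_nil ρ)) hm
  exact ⟨j, by rw [h1, h2]; exact hr, h1⟩

theorem served_numSlots (ord : net.CostOrder) {q : Input V M Req} (hq : q ∈ net.adversary)
    {y : V → M → ℝ} (hy : y ∈ net.coverAlloc) (ρ : Req) :
    served ord q y ρ (net.numSlots ρ) = q.1 ρ := by
  obtain ⟨j, hj, -⟩ := exists_repo_slot ord ρ
  exact min_eq_left (requests_le_cumCap ord hq hy hj j.2)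

/-- All requests are served, so the gain of one allocation over another comes from serving more
requests at the lower ranks. -/
theorem gain_sub_gain (ord : net.CostOrder) {q : Input V M Req} (hq : q ∈ net.adversary)
    {x y : V → M → ℝ} (hx : x ∈ net.coverAlloc) (hy : y ∈ net.coverAlloc) :
    gain ord q x - gain ord q y = ∑ ρ, ∑ k ∈ Finset.range (net.numSlots ρ - 1),
      (rankCost ord ρ (k + 1) - rankCost ord ρ k) *
        (served ord q x ρ (k + 1) - served ord q y ρ (k + 1)) := by
  unfold gain
  rw [sub_sub_sub_cancel_left, cost_eq ord q (fun v m => (hy v m).1),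
    cost_eq ord q (fun v m => (hx v m).1), ← Finset.sum_sub_distrib]
  refine Finset.sum_congr rfl fun ρ _ => ?_
  rw [served_numSlots ord hq hx, served_numSlots ord hq hy, sub_sub_sub_cancel_left,
    ← Finset.sum_sub_distrib]
  exact Finset.sum_congr rfl fun k _ => by ring

theorem rankCost_step_nonneg (ord : net.CostOrder) {ρ : Req} {k : ℕ}
    (hk : k ∈ Finset.range (net.numSlots ρ - 1)) :
    0 ≤ rankCost ord ρ (k + 1) - rankCost ord ρ k := by
  rw [Finset.mem_range] at hk
  exact sub_nonneg.2 (rankCost_mono ord ρ k.le_succ (by omega))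

theorem gain_mono (ord : net.CostOrder) {q : Input V M Req} (hq : q ∈ net.adversary)
    {x y : V → M → ℝ} (hx : x ∈ net.coverAlloc) (hy : y ∈ net.coverAlloc)
    (h : ∀ v m, x v m ≤ y v m) : gain ord q x ≤ gain ord q y := by
  rw [← sub_nonneg, gain_sub_gain ord hq hy hx]
  refine Finset.sum_nonneg fun ρ _ => Finset.sum_nonneg fun k hk =>
    mul_nonneg (rankCost_step_nonneg ord hk) (sub_nonneg.2 (min_le_min_left _ ?_))
  exact Finset.sum_le_sum fun i _ => effCap_mono ord q h ρ i

theorem worstNeeded_mem (ord : net.CostOrder) (q : Input V M Req) (y : V → M → ℝ) (ρ : Req) :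
    worstNeeded ord q y ρ < net.numSlots ρ ∧
      ((q.1 ρ : ℝ) ≤ cumCap ord q y ρ (worstNeeded ord q y ρ + 1) ∨
        worstNeeded ord q y ρ + 1 = net.numSlots ρ) := by
  have hK := numSlots_pos ord ρ
  exact Nat.sInf_mem (s := {k | k < net.numSlots ρ ∧
    ((q.1 ρ : ℝ) ≤ ∑ k' ∈ Finset.range (k + 1), effCap ord q.2 y ρ k' ∨ k + 1 = net.numSlots ρ)})
    ⟨net.numSlots ρ - 1, by omega, Or.inr (by omega)⟩

theorem worstNeeded_le (ord : net.CostOrder) (q : Input V M Req) (y : V → M → ℝ) {ρ : Req} {k : ℕ}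
    (hk : k < net.numSlots ρ) (h : (q.1 ρ : ℝ) ≤ cumCap ord q y ρ (k + 1)) :
    worstNeeded ord q y ρ ≤ k :=
  Nat.sInf_le ⟨hk, Or.inl h⟩

/-- The gain is concave and `subgrad` is one of its supergradients. -/
theorem gain_sub_gain_le (ord : net.CostOrder) {q : Input V M Req} (hq : q ∈ net.adversary)
    {u y : V → M → ℝ} (hu : u ∈ net.coverAlloc) (hy : y ∈ net.coverAlloc) :
    gain ord q u - gain ord q y ≤ ∑ v, ∑ m, subgrad ord q y v m * (u v m - y v m) := by
  have hsub : ∑ v, ∑ m, subgrad ord q y v m * (u v m - y v m) =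
      ∑ ρ, ∑ v, ∑ m, if rank ord ρ v m < (worstNeeded ord q y ρ : ℕ∞) then
        (q.2 ρ v m : ℝ) * (rankCost ord ρ (worstNeeded ord q y ρ) - net.serveCost ρ v m) *
          (u v m - y v m) else 0 := by
    symm
    rw [Finset.sum_comm]
    refine Finset.sum_congr rfl fun v _ => ?_
    rw [Finset.sum_comm]
    refine Finset.sum_congr rfl fun m _ => ?_
    rw [subgrad, Finset.sum_mul]
    refine Finset.sum_congr rfl fun ρ _ => ?_
    split_ifs
    · ring
    · ring
  rw [gain_sub_gain ord hq hu hy, hsub]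
  refine Finset.sum_le_sum fun ρ _ => ?_
  obtain ⟨hκ, hκ'⟩ := worstNeeded_mem ord q y ρ
  set κ := worstNeeded ord q y ρ with hκdef
  rw [sum_rank_lt ord ρ _ hκ.le]
  have hz : ∀ k, effCap ord q.2 u ρ k - effCap ord q.2 y ρ k =
      (cumCap ord q u ρ (k + 1) - cumCap ord q y ρ (k + 1)) -
        (cumCap ord q u ρ k - cumCap ord q y ρ k) := fun k => by
    unfold cumCap; rw [Finset.sum_range_succ, Finset.sum_range_succ]; ring
  -- only the ranks below `κ` contribute, and there the cumulative capacity of `y` is not capped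
  have h1 : ∑ k ∈ Finset.range (net.numSlots ρ - 1),
      (rankCost ord ρ (k + 1) - rankCost ord ρ k) *
        (served ord q u ρ (k + 1) - served ord q y ρ (k + 1)) ≤
      ∑ k ∈ Finset.range κ, (rankCost ord ρ (k + 1) - rankCost ord ρ k) *
        (cumCap ord q u ρ (k + 1) - cumCap ord q y ρ (k + 1)) := by
    have hsubset : Finset.range κ ⊆ Finset.range (net.numSlots ρ - 1) :=
      Finset.range_mono (by omega)
    rw [← Finset.sum_sdiff hsubset]
    have h2 : ∑ k ∈ Finset.range (net.numSlots ρ - 1) \ Finset.range κ,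
        (rankCost ord ρ (k + 1) - rankCost ord ρ k) *
          (served ord q u ρ (k + 1) - served ord q y ρ (k + 1)) ≤ 0 := by
      refine Finset.sum_nonpos fun k hk => ?_
      rw [Finset.mem_sdiff] at hk
      refine mul_nonpos_of_nonneg_of_nonpos (rankCost_step_nonneg ord hk.1) ?_
      rw [Finset.mem_range, Finset.mem_range] at hk
      have hle : (q.1 ρ : ℝ) ≤ cumCap ord q y ρ (k + 1) := by
        refine (hκ'.resolve_right (by omega)).trans ?_
        exact cumCap_mono ord q (fun v m => (hy v m).1) ρ (by omega)
      have : served ord q y ρ (k + 1) = q.1 ρ := min_eq_left hle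
      rw [this]
      exact sub_nonpos.2 (min_le_left _ _)
    have h3 : ∑ k ∈ Finset.range κ, (rankCost ord ρ (k + 1) - rankCost ord ρ k) *
        (served ord q u ρ (k + 1) - served ord q y ρ (k + 1)) ≤
        ∑ k ∈ Finset.range κ, (rankCost ord ρ (k + 1) - rankCost ord ρ k) *
          (cumCap ord q u ρ (k + 1) - cumCap ord q y ρ (k + 1)) := by
      refine Finset.sum_le_sum fun k hk => ?_
      refine mul_le_mul_of_nonneg_left ?_ (rankCost_step_nonneg ord (hsubset hk))
      rw [Finset.mem_range] at hk
      have hlt : cumCap ord q y ρ (k + 1) ≤ q.1 ρ := by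
        by_contra hcon
        have := worstNeeded_le ord q y (hk.trans hκ) (not_le.1 hcon).le
        omega
      have : served ord q y ρ (k + 1) = cumCap ord q y ρ (k + 1) := min_eq_right hlt
      rw [this]
      exact sub_le_sub_right (min_le_right _ _) _
    linarith
  refine h1.trans (le_of_eq ?_)
  have h4 : ∑ k ∈ Finset.range κ, (rankCost ord ρ κ - rankCost ord ρ k) *
      (effCap ord q.2 u ρ k - effCap ord q.2 y ρ k) =
      ∑ k ∈ Finset.range κ, (rankCost ord ρ (k + 1) - rankCost ord ρ k) *
        (cumCap ord q u ρ (k + 1) - cumCap ord q y ρ (k + 1)) := by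
    have := sum_mul_increments (fun k => rankCost ord ρ κ - rankCost ord ρ k)
      (fun k => cumCap ord q u ρ k - cumCap ord q y ρ k) κ
    simp only [cumCap, Finset.range_zero, Finset.sum_empty, sub_self, mul_zero, zero_mul,
      zero_sub, Finset.sum_range_succ _ κ, add_zero] at this
    simp only [hz]
    unfold cumCap
    rw [this, ← Finset.sum_neg_distrib]
    exact Finset.sum_congr rfl fun k _ => by ring
  rw [← h4]
  refine Finset.sum_congr rfl fun k hk => ?_
  rw [Finset.mem_range] at hk
  have hkK := hk.trans hκ
  rw [dif_pos hkK]
  have e : rankCost ord ρ k =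
      net.serveCost ρ (ord.enum ρ ⟨k, hkK⟩).1 (ord.enum ρ ⟨k, hkK⟩).2 := dif_pos hkK
  unfold effCap
  rw [dif_pos hkK, dif_pos hkK, e]
  ring

/-- The components of the supergradient are nonnegative and at most `R L Δ`: the worst needed pair
is at most as costly as the repository model at the end of the path. -/
theorem subgrad_bounds (ord : net.CostOrder) {R L : ℕ} {Δ : ℝ}
    (hR : ∀ q ∈ net.adversary, (Finset.univ.filter fun ρ => q.1 ρ ≠ 0).card ≤ R)
    (hL : ∀ v m, net.capacity v m ≤ L) (hΔ_nonneg : 0 ≤ Δ)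
    (hΔ : ∀ ρ, ∀ v ∈ net.path ρ, ∀ m, net.taskOf m = net.task ρ →
      (∑ m' with net.taskOf m' = net.task ρ,
        toVec net.repo (net.repoNode ρ) m' * net.serveCost ρ (net.repoNode ρ) m') -
          net.serveCost ρ v m ≤ Δ)
    {q : Input V M Req} (hq : q ∈ net.adversary) {y : V → M → ℝ} (hy : y ∈ net.coverAlloc)
    (v : V) (m : M) : 0 ≤ subgrad ord q y v m ∧ subgrad ord q y v m ≤ R * L * Δ := by
  have hterm : ∀ ρ, 0 ≤ (q.2 ρ v m : ℝ) *
      (rankCost ord ρ (worstNeeded ord q y ρ) - net.serveCost ρ v m) *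
        (if rank ord ρ v m < (worstNeeded ord q y ρ : ℕ∞) then 1 else 0) ∧
      (q.2 ρ v m : ℝ) * (rankCost ord ρ (worstNeeded ord q y ρ) - net.serveCost ρ v m) *
        (if rank ord ρ v m < (worstNeeded ord q y ρ : ℕ∞) then 1 else 0) ≤
        if q.1 ρ ≠ 0 then (L : ℝ) * Δ else 0 := by
    intro ρ
    by_cases hr : q.1 ρ = 0
    · have : (q.2 ρ v m : ℝ) = 0 :=
        le_antisymm (by simpa [hr] using avail_le_requests hq ρ v m) (Nat.cast_nonneg _)
      simp [this, hr]
    rw [if_pos hr]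
    split_ifs with hrank
    · obtain ⟨hκ, -⟩ := worstNeeded_mem ord q y ρ
      obtain ⟨j, hj, rfl, rfl⟩ := exists_enum_of_rank_lt ord hrank
      have e : ∀ i : Fin (net.numSlots ρ), rankCost ord ρ i =
          net.serveCost ρ (ord.enum ρ i).1 (ord.enum ρ i).2 := fun i => dif_pos i.2
      have h1 := rankCost_mono ord ρ hj.le hκ
      rw [e j] at h1
      obtain ⟨i, hi, hi'⟩ := exists_repo_slot ord ρ
      have h2 := rankCost_mono ord ρ (worstNeeded_le ord q y i.2
        (requests_le_cumCap ord hq hy hi (Nat.lt_succ_self _))) i.2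
      rw [e i] at h2
      have h3 := hΔ ρ _ (ord.enum ρ j).1.2 _ (ord.enum ρ j).2.2
      rw [Finset.sum_eq_single (ord.enum ρ i).2.1, ← hi'] at h3
      · simp only [toVec, hi, if_true, one_mul] at h3
        have h4 : (q.2 ρ (ord.enum ρ j).1 (ord.enum ρ j).2 : ℝ) ≤ L := by
          exact_mod_cast ((hq.2.1 ρ _ _).trans (min_le_left _ _)).trans (hL _ _)
        rw [mul_one]
        exact ⟨mul_nonneg (Nat.cast_nonneg _) (by linarith),
          mul_le_mul h4 (by linarith) (by linarith) (Nat.cast_nonneg _)⟩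
      · intro m' hm' hne
        have : net.repo (net.repoNode ρ) m' ≠ true := fun hr =>
          hne (net.repo_unique (net.repoNode ρ) _ _
            ((Finset.mem_filter.1 hm').2.trans (ord.enum ρ i).2.2.symm) hr (hi' ▸ hi))
        simp [toVec, this]
      · exact fun h => h.elim
          (Finset.mem_filter.2 ⟨Finset.mem_univ (ord.enum ρ i).2.1, (ord.enum ρ i).2.2⟩)
    · simp only [mul_zero, le_refl, true_and]
      positivity
  refine ⟨Finset.sum_nonneg fun ρ _ => (hterm ρ).1,
    (Finset.sum_le_sum fun ρ _ => (hterm ρ).2).trans ?_⟩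
  rw [← Finset.sum_filter, Finset.sum_const, nsmul_eq_mul, mul_assoc]
  exact mul_le_mul_of_nonneg_right (by exact_mod_cast hR q hq) (by positivity)

/-! ### Expected gain of the rounded allocation -/

/-- The repository pairs among the first `k` serve either nothing or all the requests; only for this
reason does rounding preserve, up to a factor, the part of the service beyond theirs. -/
theorem integral_served_ge (ord : net.CostOrder) {q : Input V M Req} (hq : q ∈ net.adversary)
    {y : V → M → ℝ} (hy : y ∈ net.coverAlloc) {P : V → PMF (M → Bool)}
    (hP : ∀ v, IsDepRound (net.size v) (y v) (P v)) (ρ : Req) {k : ℕ} (hk : k ≤ net.numSlots ρ) :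
    (1 - 1 / Real.exp 1) * (served ord q y ρ k - served ord q (toVec net.repo) ρ k) ≤
      ∫ x, served ord q (toVec x) ρ k ∂(Measure.pi fun v => (P v).toMeasure) -
        served ord q (toVec net.repo) ρ k := by
  have hψ : 0 ≤ 1 - 1 / Real.exp 1 := by
    rw [sub_nonneg, div_le_one (Real.exp_pos 1)]; exact Real.one_le_exp zero_le_one
  have hcap : ∀ z : V → M → ℝ, (∀ v m, 0 ≤ z v m) → 0 ≤ cumCap ord q z ρ k := fun z hz =>
    Finset.sum_nonneg fun i _ => effCap_nonneg ord q hz ρ i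
  rcases Nat.eq_zero_or_pos (q.1 ρ) with hr | hr
  · have h0 : ∀ z : V → M → ℝ, (∀ v m, 0 ≤ z v m) → served ord q z ρ k = 0 := fun z hz => by
      unfold served; rw [hr, Nat.cast_zero]; exact min_eq_left (hcap z hz)
    have h1 : ∀ x : V → M → Bool, served ord q (toVec x) ρ k = 0 := fun x =>
      h0 _ fun v m => by unfold toVec; split_ifs <;> simp
    simp [h1, h0 y fun v m => (hy v m).1]
  have hr' : (0 : ℝ) < q.1 ρ := by exact_mod_cast hr
  obtain ⟨h1, h2⟩ := integral_min_depRound_ge net.size_pos hr'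
    (w := rankCap ord q ρ k) (fun v m => ⟨rankCap_nonneg ord q ρ k v m, rankCap_le ord hq ρ k v m⟩)
    (fun v m => ⟨(hy v m).1, (hy v m).2.1⟩) hP
  simp only [← cumCap_eq_sum_rankCap ord q _ ρ hk] at h1 h2
  by_cases hex : ∃ j : Fin (net.numSlots ρ), (j : ℕ) < k ∧
      net.repo (ord.enum ρ j).1 (ord.enum ρ j).2 = true
  · obtain ⟨j, hjk, hj⟩ := hex
    have e : ∀ z ∈ net.coverAlloc, served ord q z ρ k = q.1 ρ := fun z hz =>
      min_eq_left (requests_le_cumCap ord hq hz hj hjk)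
    rw [e y hy, e _ repo_mem_coverAlloc, sub_self, mul_zero, sub_nonneg]
    refine h2 ⟨(ord.enum ρ j).1, (ord.enum ρ j).2, ?_, coverAlloc_eq_one hy hj⟩
    unfold rankCap
    rw [rank_enum, if_pos (by exact_mod_cast hjk), repo_capacity hq (ord.enum ρ j).2.2 hj]
  · have e : served ord q (toVec net.repo) ρ k = 0 := by
      have : cumCap ord q (toVec net.repo) ρ k = 0 := by
        refine Finset.sum_eq_zero fun i hi => ?_
        unfold effCap
        split_ifs with hiK
        · have : net.repo (ord.enum ρ ⟨i, hiK⟩).1 (ord.enum ρ ⟨i, hiK⟩).2 ≠ true := fun h =>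
            hex ⟨⟨i, hiK⟩, Finset.mem_range.1 hi, h⟩
          simp [toVec, this]
        · rfl
      rw [served, this, min_eq_right hr'.le]
    rw [e, sub_zero, sub_zero]
    exact h1

theorem integral_gain_ge (ord : net.CostOrder) {q : Input V M Req} (hq : q ∈ net.adversary)
    {y : V → M → ℝ} (hy : y ∈ net.coverAlloc) {P : V → PMF (M → Bool)}
    (hP : ∀ v, IsDepRound (net.size v) (y v) (P v)) :
    (1 - 1 / Real.exp 1) * gain ord q y ≤
      ∫ x, gain ord q (toVec x) ∂(Measure.pi fun v => (P v).toMeasure) := by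
  have hω : gain ord q (toVec net.repo) = 0 := sub_self _
  have hgain : gain ord q y = _ := (sub_zero _).symm.trans
    ((congrArg (gain ord q y - ·) hω.symm).trans (gain_sub_gain ord hq hy repo_mem_coverAlloc))
  set μ := Measure.pi fun v => (P v).toMeasure with hμ
  have hK : ∀ ρ, ∫ x, served ord q (toVec x) ρ (net.numSlots ρ) ∂μ = q.1 ρ := by
    intro ρ
    refine le_antisymm ?_ ?_
    · have : ∫ x, served ord q (toVec x) ρ (net.numSlots ρ) ∂μ ≤ ∫ _, (q.1 ρ : ℝ) ∂μ :=
        integral_mono .of_finite .of_finite fun x => min_le_left _ _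
      simpa using this
    · have := integral_served_ge ord hq hy hP ρ le_rfl
      rw [served_numSlots ord hq hy, served_numSlots ord hq repo_mem_coverAlloc] at this
      linarith
  have hcost : ∫ x, cost ord q (toVec x) ∂μ =
      ∑ ρ, (rankCost ord ρ (net.numSlots ρ - 1) * (q.1 ρ : ℝ) -
        ∑ k ∈ Finset.range (net.numSlots ρ - 1), (rankCost ord ρ (k + 1) - rankCost ord ρ k) *
          ∫ x, served ord q (toVec x) ρ (k + 1) ∂μ) := by
    have h0 : ∀ x : V → M → Bool, ∀ v m, 0 ≤ toVec x v m := fun x v m => by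
      unfold toVec; split_ifs <;> simp
    simp only [cost_eq ord q (h0 _)]
    rw [integral_finsetSum _ fun _ _ => .of_finite]
    refine Finset.sum_congr rfl fun ρ _ => ?_
    rw [integral_sub .of_finite .of_finite, integral_const_mul, hK,
      integral_finsetSum _ fun _ _ => .of_finite]
    simp only [integral_const_mul]
  have hint : ∫ x, gain ord q (toVec x) ∂μ = ∑ ρ, ∑ k ∈ Finset.range (net.numSlots ρ - 1),
      (rankCost ord ρ (k + 1) - rankCost ord ρ k) *
        (∫ x, served ord q (toVec x) ρ (k + 1) ∂μ - served ord q (toVec net.repo) ρ (k + 1)) := by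
    unfold gain
    rw [integral_sub .of_finite .of_finite, hcost]
    simp only [integral_const, probReal_univ, smul_eq_mul, one_mul]
    rw [cost_eq ord q fun v m => (repo_mem_coverAlloc v m).1, ← Finset.sum_sub_distrib]
    refine Finset.sum_congr rfl fun ρ _ => ?_
    rw [served_numSlots ord hq repo_mem_coverAlloc, sub_sub_sub_cancel_left,
      ← Finset.sum_sub_distrib]
    exact Finset.sum_congr rfl fun k _ => by ring
  rw [hgain, hint, Finset.mul_sum]
  refine Finset.sum_le_sum fun ρ _ => ?_
  rw [Finset.mul_sum]
  refine Finset.sum_le_sum fun k hk => ?_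
  rw [mul_left_comm]
  refine mul_le_mul_of_nonneg_left ?_ (rankCost_step_nonneg ord hk)
  rw [Finset.mem_range] at hk
  exact integral_served_ge ord hq hy hP ρ (by omega)

/-! ### Mirror descent at one node -/

theorem mirrorMap_eq (v : V) (y : M → ℝ) :
    net.mirrorMap v y = ∑ m, net.size v m * (y m * Real.log (y m)) :=
  Finset.sum_congr rfl fun _ _ => mul_assoc _ _ _

theorem mirrorGrad_eq (v : V) {y : M → ℝ} {m : M} (hy : 0 < y m) :
    net.mirrorGrad v y m = net.size v m * (Real.log (y m) + 1) := by
  unfold mirrorGrad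
  have h1 : (fun τ => net.mirrorMap v (Function.update y m τ)) = fun τ =>
      net.size v m * (τ * Real.log τ) +
        ∑ k ∈ Finset.univ.erase m, net.size v k * (y k * Real.log (y k)) := by
    funext τ
    rw [mirrorMap_eq, ← Finset.add_sum_erase _ _ (Finset.mem_univ m), Function.update_self]
    congr 1
    exact Finset.sum_congr rfl fun k hk => by
      rw [Function.update_of_ne (Finset.ne_of_mem_erase hk)]
  rw [h1]
  exact (((Real.hasDerivAt_mul_log hy.ne').const_mul _).add_const _).deriv

theorem bregman_eq (v : V) (u : M → ℝ) {y : M → ℝ} (hy : y ∈ posOrthant M) :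
    net.bregman v u y =
      ∑ m, net.size v m * (u m * Real.log (u m) - u m * Real.log (y m) - u m + y m) := by
  unfold bregman
  rw [mirrorMap_eq, mirrorMap_eq, ← Finset.sum_sub_distrib, ← Finset.sum_sub_distrib]
  refine Finset.sum_congr rfl fun m _ => ?_
  rw [mirrorGrad_eq v (hy m)]
  ring

variable (net) in
/-- The mirror map of node `v` minus a linear form. -/
def tilted (v : V) (a y : M → ℝ) : ℝ := net.mirrorMap v y - ∑ m, a m * y m

theorem fracAlloc_convex (v : V) {y u : M → ℝ} (hy : y ∈ net.fracAlloc v)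
    (hu : u ∈ net.fracAlloc v) {τ : ℝ} (h0 : 0 ≤ τ) (h1 : τ ≤ 1) :
    (fun m => (1 - τ) * y m + τ * u m) ∈ net.fracAlloc v := by
  obtain ⟨y1, y2, y3⟩ := hy
  obtain ⟨u1, u2, u3⟩ := hu
  have h1' : 0 ≤ 1 - τ := by linarith
  refine ⟨fun m => ⟨?_, ?_⟩, fun m => ?_, ?_⟩
  · exact add_nonneg (mul_nonneg h1' (y1 m).1) (mul_nonneg h0 (u1 m).1)
  · nlinarith [y1 m, u1 m]
  · nlinarith [y2 m, u2 m]
  · split_ifs at y3 u3 ⊢ with hb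
    · simp only [add_mul, mul_assoc, Finset.sum_add_distrib, ← Finset.mul_sum, y3, u3]
      ring
    · intro m
      simp only [y3 m, u3 m]; ring

theorem isCompact_fracAlloc (v : V) : IsCompact (net.fracAlloc v) := by
  refine (isCompact_Icc (a := (0 : M → ℝ)) (b := 1)).of_isClosed_subset ?_
    fun y hy => ⟨fun m => (hy.1 m).1, fun m => (hy.1 m).2⟩
  have h1 : IsClosed {y : M → ℝ | ∀ m, 0 ≤ y m ∧ y m ≤ 1} := by
    simp only [Set.ofPred_forall]
    exact isClosed_iInter fun m => (isClosed_le continuous_const (continuous_apply m)).inter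
      (isClosed_le (continuous_apply m) continuous_const)
  have h2 : IsClosed {y : M → ℝ | ∀ m, toVec net.repo v m ≤ y m} := by
    simp only [Set.ofPred_forall]
    exact isClosed_iInter fun m => isClosed_le continuous_const (continuous_apply m)
  have h3 : IsClosed {y : M → ℝ | if net.budget v ≤ ∑ m, net.size v m then
      ∑ m, y m * net.size v m = net.budget v else ∀ m, y m = 1} := by
    by_cases hb : net.budget v ≤ ∑ m, net.size v m
    · simp only [hb, if_true]
      exact isClosed_eq (by fun_prop) continuous_const
    · simp only [hb, if_false, Set.ofPred_forall]
      exact isClosed_iInter fun m => isClosed_eq (continuous_apply m) continuous_const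
  exact h1.inter (h2.inter h3)

theorem continuous_tilted (v : V) (a : M → ℝ) : Continuous (net.tilted v a) := by
  unfold tilted
  simp only [mirrorMap_eq]
  refine Continuous.sub (continuous_finsetSum _ fun m _ => ?_) (by fun_prop)
  exact (Real.continuous_mul_log.comp (continuous_apply m)).const_mul _

/-- A tilted entropy attains its minimum over the positive fractional allocations: it does so over
the compact set of all fractional allocations, and its slope `-∞` at the boundary of the orthant
keeps the minimizer away from it. -/
theorem exists_isMinOn_tilted {v : V} (hpos : (net.fracAlloc v ∩ posOrthant M).Nonempty)
    (a : M → ℝ) : ∃ y ∈ net.fracAlloc v ∩ posOrthant M,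
      IsMinOn (net.tilted v a) (net.fracAlloc v ∩ posOrthant M) y := by
  obtain ⟨p, hpF, hp⟩ := hpos
  obtain ⟨y, hy, hmin⟩ := (isCompact_fracAlloc v).exists_isMinOn ⟨p, hpF⟩
    (continuous_tilted (net := net) v a).continuousOn
  refine ⟨y, ⟨hy, fun m₀ => ?_⟩, hmin.on_subset Set.inter_subset_left⟩
  by_contra hcon
  have hy0 : y m₀ = 0 := le_antisymm (not_lt.1 hcon) (hy.1 m₀).1
  have key : ∀ τ : ℝ, 0 < τ → τ < 1 →
      0 ≤ net.tilted v a p - net.tilted v a y + net.size v m₀ * p m₀ * Real.log τ := by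
    intro τ h0 h1
    have hz := hmin (fracAlloc_convex v hy hpF h0.le h1.le)
    simp only [Set.mem_ofPred_eq] at hz
    have hterm : ∀ m, net.size v m * (((1 - τ) * y m + τ * p m) *
        Real.log ((1 - τ) * y m + τ * p m)) ≤
        (1 - τ) * (net.size v m * (y m * Real.log (y m))) +
          τ * (net.size v m * (p m * Real.log (p m))) +
          (if m = m₀ then τ * (net.size v m₀ * p m₀ * Real.log τ) else 0) := by
      intro m
      split_ifs with hm
      · subst hm
        rw [hy0, mul_zero, zero_add, Real.log_mul h0.ne' (hp m).ne']
        refine le_of_eq ?_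
        ring
      · have := Real.convexOn_mul_log.2 (Set.mem_Ici.2 (hy.1 m).1) (Set.mem_Ici.2 (hp m).le)
          (show 0 ≤ 1 - τ by linarith) h0.le (by ring)
        simp only [smul_eq_mul] at this
        have := mul_le_mul_of_nonneg_left this (net.size_pos v m).le
        linarith
    have hsum := Finset.sum_le_sum fun m (_ : m ∈ Finset.univ) => hterm m
    simp only [Finset.sum_add_distrib, ← Finset.mul_sum, Finset.sum_ite_eq', Finset.mem_univ,
      if_true] at hsum
    unfold tilted at hz ⊢
    simp only [mirrorMap_eq, mul_add, Finset.sum_add_distrib] at hz ⊢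
    have e1 : ∑ m, a m * ((1 - τ) * y m) = (1 - τ) * ∑ m, a m * y m := by
      rw [Finset.mul_sum]; exact Finset.sum_congr rfl fun m _ => by ring
    have e2 : ∑ m, a m * (τ * p m) = τ * ∑ m, a m * p m := by
      rw [Finset.mul_sum]; exact Finset.sum_congr rfl fun m _ => by ring
    rw [e1, e2] at hz
    refine nonneg_of_mul_nonneg_right ?_ h0
    nlinarith
  set D := net.tilted v a p - net.tilted v a y with hD
  have hsp : 0 < net.size v m₀ * p m₀ := mul_pos (net.size_pos v m₀) (hp m₀)
  have h := key (Real.exp (-((|D| + 1) / (net.size v m₀ * p m₀)))) (Real.exp_pos _)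
    (Real.exp_lt_one_iff.2 (neg_neg_of_pos (by positivity)))
  rw [Real.log_exp, mul_neg, mul_div_cancel₀ _ hsp.ne'] at h
  linarith [le_abs_self D]

/-- First-order optimality condition; the comparison point may have zero components. -/
theorem first_order_optimality {v : V} {a y u : M → ℝ}
    (hy : y ∈ net.fracAlloc v ∩ posOrthant M)
    (hmin : IsMinOn (net.tilted v a) (net.fracAlloc v ∩ posOrthant M) y)
    (hu : u ∈ net.fracAlloc v) :
    0 ≤ ∑ m, (net.size v m * (Real.log (y m) + 1) - a m) * (u m - y m) := by
  have hz : ∀ m, (1 - (0 : ℝ)) * y m + 0 * u m = y m := fun m => by ring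
  have hder : HasDerivAt (fun τ : ℝ => net.tilted v a fun m => (1 - τ) * y m + τ * u m)
      (∑ m, (net.size v m * (Real.log (y m) + 1) - a m) * (u m - y m)) 0 := by
    have hlin : ∀ m, HasDerivAt (fun τ : ℝ => (1 - τ) * y m + τ * u m) (u m - y m) 0 := fun m => by
      have := (((hasDerivAt_id (0 : ℝ)).const_sub 1).mul_const (y m)).add
        ((hasDerivAt_id (0 : ℝ)).mul_const (u m))
      exact this.congr_deriv (by ring)
    have hent : ∀ m, HasDerivAt (fun τ : ℝ => net.size v m *
        (((1 - τ) * y m + τ * u m) * Real.log ((1 - τ) * y m + τ * u m)))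
        (net.size v m * ((Real.log (y m) + 1) * (u m - y m))) 0 := fun m => by
      have h1 : HasDerivAt (fun z : ℝ => z * Real.log z) (Real.log (y m) + 1)
          ((1 - (0 : ℝ)) * y m + 0 * u m) := by
        rw [hz m]; exact Real.hasDerivAt_mul_log (hy.2 m).ne'
      exact (h1.comp (0 : ℝ) (hlin m)).const_mul _
    have h := (HasDerivAt.fun_sum fun m (_ : m ∈ Finset.univ) => hent m).sub
      (HasDerivAt.fun_sum fun m (_ : m ∈ Finset.univ) => (hlin m).const_mul (a m))
    have hfun : (fun τ : ℝ => net.tilted v a fun m => (1 - τ) * y m + τ * u m) = fun τ =>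
        ∑ m, net.size v m * (((1 - τ) * y m + τ * u m) * Real.log ((1 - τ) * y m + τ * u m)) -
          ∑ m, a m * ((1 - τ) * y m + τ * u m) := by
      funext τ
      rw [tilted, mirrorMap_eq]
    rw [hfun]
    refine h.congr_deriv ?_
    rw [← Finset.sum_sub_distrib]
    exact Finset.sum_congr rfl fun m _ => by ring
  have ht := (hasDerivWithinAt_iff_tendsto_slope' (s := Set.Ioi (0 : ℝ)) (by simp)).1
    hder.hasDerivWithinAt
  refine ge_of_tendsto ht ?_
  filter_upwards [Ioo_mem_nhdsGT (zero_lt_one' ℝ)] with τ hτ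
  have hmem : (fun m => (1 - τ) * y m + τ * u m) ∈ net.fracAlloc v ∩ posOrthant M := by
    refine ⟨fracAlloc_convex v hy.1 hu hτ.1.le hτ.2.le, fun m => ?_⟩
    exact add_pos_of_pos_of_nonneg (mul_pos (by linarith [hτ.2]) (hy.2 m))
      (mul_nonneg hτ.1.le (hu.1 m).1)
  have h1 := hmin hmem
  simp only [Set.mem_ofPred_eq] at h1
  rw [slope_def_field]
  refine div_nonneg (sub_nonneg.2 ?_) (by linarith [hτ.1])
  simpa only [hz] using h1

theorem argminOn_spec {α : Type*} [Nonempty α] {f : α → ℝ} {S : Set α}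
    (h : ∃ y ∈ S, IsMinOn f S y) : argminOn f S ∈ S ∧ IsMinOn f S (argminOn f S) :=
  Classical.epsilon_spec (p := fun y => y ∈ S ∧ IsMinOn f S y) h

theorem bregman_eq_tilted (v : V) (y h : M → ℝ) :
    net.bregman v y h = net.tilted v (net.mirrorGrad v h) y -
      net.tilted v (net.mirrorGrad v h) h := by
  unfold bregman tilted
  simp only [mul_sub, Finset.sum_sub_distrib]
  ring

theorem bregmanProj_spec {v : V} (hpos : (net.fracAlloc v ∩ posOrthant M).Nonempty)
    (h : M → ℝ) : net.bregmanProj v h ∈ net.fracAlloc v ∩ posOrthant M ∧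
      IsMinOn (net.tilted v (net.mirrorGrad v h)) (net.fracAlloc v ∩ posOrthant M)
        (net.bregmanProj v h) := by
  have hiff : ∀ y, IsMinOn (fun y => net.bregman v y h) (net.fracAlloc v ∩ posOrthant M) y ↔
      IsMinOn (net.tilted v (net.mirrorGrad v h)) (net.fracAlloc v ∩ posOrthant M) y := fun y => by
    simp only [isMinOn_iff, bregman_eq_tilted, sub_le_sub_iff_right]
  obtain ⟨y, hy, hmin⟩ := exists_isMinOn_tilted hpos (net.mirrorGrad v h)
  have := argminOn_spec (f := fun y => net.bregman v y h) ⟨y, hy, (hiff y).2 hmin⟩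
  exact ⟨this.1, (hiff _).1 this.2⟩

/-- The mirror gradient maps the positive orthant onto the whole space. -/
theorem mirrorGrad_invFunOn (v : V) (a : M → ℝ) :
    net.mirrorGrad v (Function.invFunOn (net.mirrorGrad v) (posOrthant M) a) = a := by
  refine Function.invFunOn_eq ⟨fun m => Real.exp (a m / net.size v m - 1),
    fun m => Real.exp_pos _, ?_⟩
  funext m
  rw [mirrorGrad_eq v (y := fun m => Real.exp (a m / net.size v m - 1)) (Real.exp_pos _),
    Real.log_exp, sub_add_cancel,
    mul_div_cancel₀ _ (net.size_pos v m).ne']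

theorem bregman_nonneg (v : V) {u y : M → ℝ} (hu : u ∈ net.fracAlloc v)
    (hy : y ∈ net.fracAlloc v ∩ posOrthant M) : 0 ≤ net.bregman v u y := by
  rw [bregman_eq v u hy.2]
  refine Finset.sum_nonneg fun m _ => mul_nonneg (net.size_pos v m).le ?_
  rcases (hu.1 m).1.eq_or_lt with h | h
  · rw [← h]; simpa using (hy.2 m).le
  · exact le_trans (by positivity)
      (sq_sub_div_two_le_entropy_remainder (hy.2 m) (hy.1.1 m).2 h (hu.1 m).2)

/-- One step of mirror descent. The three-point identity turns the optimality of the new state `y'`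
into a bound by a difference of divergences, and strong convexity absorbs the displacement
`y' - y`. -/
theorem mirror_step {v : V} {η : ℝ} {g u y y' : M → ℝ} (hu : u ∈ net.fracAlloc v)
    (hy : y ∈ net.fracAlloc v ∩ posOrthant M) (hy' : y' ∈ net.fracAlloc v ∩ posOrthant M)
    (hmin : IsMinOn (net.tilted v (net.mirrorGrad v y + η • g))
      (net.fracAlloc v ∩ posOrthant M) y') :
    η * ∑ m, g m * (u m - y m) ≤ net.bregman v u y - net.bregman v u y' +
      ∑ m, (η * g m) ^ 2 / (2 * net.size v m) := by
  have hopt := first_order_optimality hy' hmin hu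
  rw [bregman_eq v u hy.2, bregman_eq v u hy'.2, Finset.mul_sum, ← Finset.sum_sub_distrib,
    ← Finset.sum_add_distrib]
  refine le_trans ?_ (sub_le_self _ hopt)
  rw [← Finset.sum_sub_distrib]
  refine Finset.sum_le_sum fun m _ => ?_
  have hs := net.size_pos v m
  rw [Pi.add_apply, Pi.smul_apply, smul_eq_mul, mirrorGrad_eq v (hy.2 m)]
  have h1 := mul_le_mul_of_nonneg_left (sq_sub_div_two_le_entropy_remainder (hy.2 m) (hy.1.1 m).2
    (hy'.2 m) (hy'.1.1 m).2) hs.le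
  have h2 : η * g m * (y' m - y m) - net.size v m * ((y' m - y m) ^ 2 / 2) ≤
      (η * g m) ^ 2 / (2 * net.size v m) := by
    rw [le_div_iff₀ (by positivity)]
    nlinarith [sq_nonneg (η * g m - net.size v m * (y' m - y m))]
  linarith

theorem fracAlloc_sum {v : V} {y : M → ℝ} (hy : y ∈ net.fracAlloc v) :
    ∑ m, net.size v m * y m = min (net.budget v) (∑ m, net.size v m) := by
  have h := hy.2.2
  split_ifs at h with hb
  · rw [min_eq_left hb, ← h]; exact Finset.sum_congr rfl fun m _ => mul_comm _ _
  · rw [min_eq_right (not_le.1 hb).le]; simp [h]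

/-- Jensen's inequality for the entropy, with `log x ≤ x - 1` as tangent. -/
theorem neg_mirrorMap_le {v : V} {y : M → ℝ} (hy : y ∈ net.fracAlloc v ∩ posOrthant M) :
    -net.mirrorMap v y ≤ min (net.budget v) (∑ m, net.size v m) *
      Real.log ((∑ m, net.size v m) / min (net.budget v) (∑ m, net.size v m)) := by
  rcases isEmpty_or_nonempty M with hM | hM
  · simp [mirrorMap, (net.budget_pos v).le]
  have hS : 0 < ∑ m, net.size v m :=
    Finset.sum_pos (fun m _ => net.size_pos v m) Finset.univ_nonempty
  have hsum := fracAlloc_sum hy.1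
  set S := ∑ m, net.size v m with hSdef
  set B := min (net.budget v) S with hB
  have hB0 : 0 < B := lt_min (net.budget_pos v) hS
  have hterm : ∀ m, -(net.size v m * (y m * Real.log (y m))) ≤
      net.size v m * y m * Real.log (S / B) + (net.size v m * (B / S) - net.size v m * y m) := by
    intro m
    have hym := hy.2 m
    have h1 := Real.log_le_sub_one_of_pos (show 0 < B / (S * y m) by positivity)
    rw [Real.log_div hB0.ne' (by positivity), Real.log_mul hS.ne' hym.ne'] at h1
    rw [Real.log_div hS.ne' hB0.ne']
    have h2 := mul_le_mul_of_nonneg_left h1 (mul_pos (net.size_pos v m) hym).le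
    have h3 : net.size v m * y m * (B / (S * y m) - 1) =
        net.size v m * (B / S) - net.size v m * y m := by field_simp
    rw [h3] at h2
    linarith
  rw [mirrorMap_eq, ← Finset.sum_neg_distrib]
  refine (Finset.sum_le_sum fun m _ => hterm m).trans (le_of_eq ?_)
  rw [Finset.sum_add_distrib, Finset.sum_sub_distrib, ← Finset.sum_mul, ← Finset.sum_mul, hsum,
    ← hSdef]
  field_simp
  ring

theorem bregman_init_le {v : V} {u y : M → ℝ} (hu : u ∈ net.fracAlloc v)
    (hy : y ∈ net.fracAlloc v ∩ posOrthant M)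
    (hmin : IsMinOn (net.mirrorMap v) (net.fracAlloc v ∩ posOrthant M) y) :
    net.bregman v u y ≤ min (net.budget v) (∑ m, net.size v m) *
      Real.log ((∑ m, net.size v m) / min (net.budget v) (∑ m, net.size v m)) := by
  have h0 : net.tilted v 0 = net.mirrorMap v := by funext z; simp [tilted]
  have hopt := first_order_optimality (a := 0) hy (h0 ▸ hmin) hu
  have hle := neg_mirrorMap_le hy
  have hu0 : net.mirrorMap v u ≤ 0 := by
    rw [mirrorMap_eq]
    exact Finset.sum_nonpos fun m _ => mul_nonpos_of_nonneg_of_nonpos (net.size_pos v m).le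
      (Real.mul_log_nonpos (hu.1 m).1 (hu.1 m).2)
  have hgrad : ∑ m, (net.size v m * (Real.log (y m) + 1) - (0 : M → ℝ) m) * (u m - y m) =
      ∑ m, net.mirrorGrad v y m * (u m - y m) :=
    Finset.sum_congr rfl fun m _ => by rw [mirrorGrad_eq v (hy.2 m), Pi.zero_apply, sub_zero]
  rw [hgrad] at hopt
  unfold bregman
  linarith

/-! ### Regret of the fractional states -/

theorem infidaState_mem (hpos : ∀ v, (net.fracAlloc v ∩ posOrthant M).Nonempty)
    (ord : net.CostOrder) (η : ℝ) (q : ℕ → Input V M Req) (t : ℕ) (v : V) :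
    infidaState ord η q t v ∈ net.fracAlloc v ∩ posOrthant M := by
  cases t with
  | zero =>
    have h0 : net.tilted v 0 = net.mirrorMap v := by funext z; simp [tilted]
    exact (argminOn_spec (h0 ▸ exists_isMinOn_tilted (hpos v) 0)).1
  | succ t => exact (bregmanProj_spec (hpos v) _).1

theorem infidaState_isMinOn (hpos : ∀ v, (net.fracAlloc v ∩ posOrthant M).Nonempty)
    (ord : net.CostOrder) (η : ℝ) (q : ℕ → Input V M Req) (t : ℕ) (v : V) :
    IsMinOn (net.tilted v (net.mirrorGrad v (infidaState ord η q t v) +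
      η • subgrad ord (q t) (infidaState ord η q t) v)) (net.fracAlloc v ∩ posOrthant M)
      (infidaState ord η q (t + 1) v) := by
  have h := (bregmanProj_spec (hpos v) (Function.invFunOn (net.mirrorGrad v) (posOrthant M)
    (net.mirrorGrad v (infidaState ord η q t v) +
      η • subgrad ord (q t) (infidaState ord η q t) v))).2
  rwa [mirrorGrad_invFunOn] at h

theorem coverAlloc_of_fracAlloc {y : V → M → ℝ} (hy : ∀ v, y v ∈ net.fracAlloc v) :
    y ∈ net.coverAlloc := fun v m =>
  ⟨((hy v).1 m).1, ((hy v).1 m).2, (hy v).2.1 m⟩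

/-- An integral allocation within the budget extends to a fractional one that uses the budget. -/
theorem exists_fracAlloc_ge {x : V → M → Bool} (hx : x ∈ net.intAlloc) (v : V) :
    ∃ u ∈ net.fracAlloc v, ∀ m, toVec x v m ≤ u m := by
  obtain ⟨hb, hω⟩ := hx v
  have h01 : ∀ m, 0 ≤ toVec x v m ∧ toVec x v m ≤ 1 := fun m => by
    unfold toVec; split_ifs <;> simp
  have hω1 : ∀ m, toVec net.repo v m ≤ 1 := fun m => by unfold toVec; split_ifs <;> simp
  by_cases hS : net.budget v ≤ ∑ m, net.size v m
  · set X := ∑ m, toVec x v m * net.size v m with hX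
    set S := ∑ m, net.size v m with hSdef
    -- interpolate between `x` and the constant `1`; if `S = X`, then `τ = 0 / 0 = 0`
    set τ := (net.budget v - X) / (S - X) with hτ
    have hτ0 : 0 ≤ τ := div_nonneg (by linarith) (by linarith)
    have hτ1 : τ ≤ 1 := div_le_one_of_le₀ (by linarith) (by linarith)
    have hτX : τ * (S - X) = net.budget v - X := by
      rcases eq_or_ne (S - X) 0 with h | h
      · rw [h, mul_zero]; linarith
      · exact div_mul_cancel₀ _ h
    have hge : ∀ m, toVec x v m ≤ toVec x v m + τ * (1 - toVec x v m) := fun m => by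
      nlinarith [h01 m]
    refine ⟨fun m => toVec x v m + τ * (1 - toVec x v m),
      ⟨fun m => ⟨(h01 m).1.trans (hge m), by nlinarith [h01 m]⟩,
        fun m => (hω m).trans (hge m), ?_⟩, hge⟩
    rw [if_pos hS]
    have : ∀ m, (toVec x v m + τ * (1 - toVec x v m)) * net.size v m =
        toVec x v m * net.size v m + τ * (net.size v m - toVec x v m * net.size v m) :=
      fun m => by ring
    simp only [this, Finset.sum_add_distrib, ← Finset.mul_sum, Finset.sum_sub_distrib]
    linarith
  · exact ⟨fun _ => 1, ⟨fun m => by simp, hω1, by rw [if_neg hS]; simp⟩, fun m => (h01 m).2⟩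

theorem repo_mem_intAlloc (hpos : ∀ v, (net.fracAlloc v ∩ posOrthant M).Nonempty) :
    net.repo ∈ net.intAlloc := by
  intro v
  obtain ⟨y, hy, -⟩ := hpos v
  refine ⟨?_, fun m => le_rfl⟩
  calc ∑ m, toVec net.repo v m * net.size v m ≤ ∑ m, net.size v m * y m :=
        Finset.sum_le_sum fun m _ => by
          rw [mul_comm]; exact mul_le_mul_of_nonneg_left (hy.2.1 m) (net.size_pos v m).le
    _ ≤ net.budget v := (fracAlloc_sum hy).trans_le (min_le_left _ _)

theorem sizeMin_le (v : V) (m : M) : net.sizeMin ≤ net.size v m :=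
  ciInf_le (f := fun a : V × M => net.size a.1 a.2) (Set.finite_range _).bddBelow (v, m)

theorem le_sizeMax (v : V) (m : M) : net.size v m ≤ net.sizeMax :=
  le_ciSup (f := fun a : V × M => net.size a.1 a.2) (Set.finite_range _).bddAbove (v, m)

theorem sizeMin_nonneg : 0 ≤ net.sizeMin :=
  Real.iInf_nonneg fun a => (net.size_pos a.1 a.2).le

theorem sizeMin_pos [Nonempty V] [Nonempty M] : 0 < net.sizeMin := by
  obtain ⟨a, ha⟩ := Finite.exists_min fun a : V × M => net.size a.1 a.2
  exact (net.size_pos a.1 a.2).trans_le (le_ciInf ha)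

theorem sizeMax_pos [Nonempty V] [Nonempty M] : 0 < net.sizeMax :=
  (net.size_pos (Classical.arbitrary V) (Classical.arbitrary M)).trans_le (le_sizeMax _ _)

theorem sum_sq_div_size_le [Nonempty V] [Nonempty M] {G : ℝ} {g : V → M → ℝ}
    (hg : ∀ v m, 0 ≤ g v m ∧ g v m ≤ G) (η : ℝ) :
    ∑ v, ∑ m, (η * g v m) ^ 2 / (2 * net.size v m) ≤
      (η * (G / net.sizeMin)) ^ 2 / (2 * net.convexity) := by
  have h0 := sizeMin_pos (net := net)
  have hterm : ∀ v m, (η * g v m) ^ 2 / (2 * net.size v m) ≤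
      (η * (G / net.sizeMin)) ^ 2 * net.sizeMax / 2 := by
    intro v m
    have hs := net.size_pos v m
    have h1 : (η * g v m) ^ 2 ≤ (η * G) ^ 2 := by
      rw [mul_pow, mul_pow]
      exact mul_le_mul_of_nonneg_left (pow_le_pow_left₀ (hg v m).1 (hg v m).2 2) (sq_nonneg _)
    calc (η * g v m) ^ 2 / (2 * net.size v m) ≤ (η * G) ^ 2 / (2 * net.size v m) :=
          div_le_div_of_nonneg_right h1 (by positivity)
      _ = (η * G) ^ 2 / 2 * (1 / net.size v m) := by field_simp
      _ ≤ (η * G) ^ 2 / 2 * (net.sizeMax / net.sizeMin ^ 2) := by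
          refine mul_le_mul_of_nonneg_left ?_ (by positivity)
          rw [div_le_div_iff₀ hs (by positivity), one_mul, sq]
          exact mul_le_mul ((sizeMin_le v m).trans (le_sizeMax v m)) (sizeMin_le v m) h0.le
            sizeMax_pos.le
      _ = _ := by field_simp
  refine (Finset.sum_le_sum fun v _ => Finset.sum_le_sum fun m _ => hterm v m).trans
    (le_of_eq ?_)
  have hV : (Fintype.card V : ℝ) ≠ 0 := by exact_mod_cast Fintype.card_ne_zero
  have hM : (Fintype.card M : ℝ) ≠ 0 := by exact_mod_cast Fintype.card_ne_zero
  have hmax := (sizeMax_pos (net := net)).ne'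
  simp only [Finset.sum_const, Finset.card_univ, nsmul_eq_mul, convexity]
  field_simp

/-- The mirror descent bound for an arbitrary learning rate. -/
theorem infidaState_linear_regret [Nonempty V] [Nonempty M]
    (hpos : ∀ v, (net.fracAlloc v ∩ posOrthant M).Nonempty) (ord : net.CostOrder) (η : ℝ)
    (q : ℕ → Input V M Req) {G : ℝ} {T : ℕ}
    (hg : ∀ t < T, ∀ v m, 0 ≤ subgrad ord (q t) (infidaState ord η q t) v m ∧
      subgrad ord (q t) (infidaState ord η q t) v m ≤ G)
    {u : V → M → ℝ} (hu : ∀ v, u v ∈ net.fracAlloc v) :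
    η * ∑ t ∈ Finset.range T, ∑ v, ∑ m, subgrad ord (q t) (infidaState ord η q t) v m *
        (u v m - infidaState ord η q t v m) ≤
      net.divBound + T * ((η * (G / net.sizeMin)) ^ 2 / (2 * net.convexity)) := by
  have key : ∀ n ≤ T, η * ∑ t ∈ Finset.range n, ∑ v, ∑ m,
      subgrad ord (q t) (infidaState ord η q t) v m * (u v m - infidaState ord η q t v m) ≤
      ∑ v, net.bregman v (u v) (infidaState ord η q 0 v) -
        ∑ v, net.bregman v (u v) (infidaState ord η q n v) +
        n * ((η * (G / net.sizeMin)) ^ 2 / (2 * net.convexity)) := by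
    intro n
    induction n with
    | zero => intro _; simp
    | succ n ih =>
      intro hn
      have h1 := ih (by omega)
      have h2 := Finset.sum_le_sum fun v (_ : v ∈ Finset.univ) =>
        mirror_step (hu v) (infidaState_mem hpos ord η q n v)
          (infidaState_mem hpos ord η q (n + 1) v) (infidaState_isMinOn hpos ord η q n v)
      rw [Finset.sum_add_distrib, Finset.sum_sub_distrib, ← Finset.mul_sum] at h2
      have h3 := sum_sq_div_size_le (net := net) (hg n (by omega)) η
      rw [Finset.sum_range_succ, mul_add]
      push_cast
      linarith
  have h := key T le_rfl
  have hT : 0 ≤ ∑ v, net.bregman v (u v) (infidaState ord η q T v) :=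
    Finset.sum_nonneg fun v _ => bregman_nonneg v (hu v) (infidaState_mem hpos ord η q T v)
  have h0 : ∑ v, net.bregman v (u v) (infidaState ord η q 0 v) ≤ net.divBound := by
    refine Finset.sum_le_sum fun v _ => ?_
    have e : net.tilted v 0 = net.mirrorMap v := by funext z; simp [tilted]
    have hs := argminOn_spec (e ▸ exists_isMinOn_tilted (hpos v) 0)
    exact bregman_init_le (hu v) hs.1 hs.2
  linarith

theorem divBound_term_nonneg [Nonempty M] (v : V) :
    0 ≤ min (net.budget v) (∑ m, net.size v m) *
      Real.log ((∑ m, net.size v m) / min (net.budget v) (∑ m, net.size v m)) := by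
  have hS : 0 < ∑ m, net.size v m :=
    Finset.sum_pos (fun m _ => net.size_pos v m) Finset.univ_nonempty
  have hB := lt_min (net.budget_pos v) hS
  exact mul_nonneg hB.le (Real.log_nonneg ((one_le_div hB).2 (min_le_right _ _)))

/-- If `divBound` vanishes, every node has to store the whole catalog. -/
theorem fracAlloc_eq_one_of_divBound [Nonempty M] (h : net.divBound = 0) {v : V} {y : M → ℝ}
    (hy : y ∈ net.fracAlloc v) (m : M) : y m = 1 := by
  have hS : 0 < ∑ m, net.size v m :=
    Finset.sum_pos (fun m _ => net.size_pos v m) Finset.univ_nonempty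
  have hB := lt_min (net.budget_pos v) hS
  have h1 := (Finset.sum_eq_zero_iff_of_nonneg fun v _ => divBound_term_nonneg v).1 h v
    (Finset.mem_univ v)
  have h2 : (∑ m, net.size v m) / min (net.budget v) (∑ m, net.size v m) = 1 :=
    Real.eq_one_of_pos_of_log_eq_zero (div_pos hS hB) ((mul_eq_zero.1 h1).resolve_left hB.ne')
  rw [div_eq_one_iff_eq hB.ne', ← fracAlloc_sum hy] at h2
  have h3 : ∑ m, net.size v m * (1 - y m) = 0 := by
    simp only [mul_sub, mul_one, Finset.sum_sub_distrib]; linarith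
  have h4 := (Finset.sum_eq_zero_iff_of_nonneg fun m _ =>
    mul_nonneg (net.size_pos v m).le (sub_nonneg.2 (hy.1 m).2)).1 h3 m (Finset.mem_univ m)
  have h5 := (mul_eq_zero.1 h4).resolve_left (net.size_pos v m).ne'
  linarith

/-- The learning rate `(1 / σ) √(2 θ D / T)`, with `θ = 1 / B`, balances the two parts of the
mirror descent bound. -/
theorem le_of_balanced_rate {σ B D T Q : ℝ} (hσ : 0 < σ) (hB : 0 < B) (hD : 0 < D) (hT : 0 < T)
    (h : 1 / σ * √(2 * (1 / B) * D / T) * Q ≤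
      D + T * ((1 / σ * √(2 * (1 / B) * D / T) * σ) ^ 2 / (2 * (1 / B)))) :
    Q ≤ σ * √B * √(2 * D) * √T := by
  have hr : √(2 * (1 / B) * D / T) = √(2 * D) / (√B * √T) := by
    rw [← Real.sqrt_mul hB.le, ← Real.sqrt_div (by positivity)]
    congr 1
    field_simp
  have hsq : (1 / σ * √(2 * (1 / B) * D / T) * σ) ^ 2 = 2 * (1 / B) * D / T := by
    rw [mul_right_comm, one_div_mul_cancel hσ.ne', one_mul, Real.sq_sqrt (by positivity)]
  have hpos : 0 < 1 / σ * √(2 * (1 / B) * D / T) := by positivity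
  have hQ : 1 / σ * √(2 * (1 / B) * D / T) * (σ * √B * √(2 * D) * √T) = 2 * D := by
    rw [hr, ← Real.mul_self_sqrt (show 0 ≤ 2 * D by positivity)]
    have := Real.sqrt_pos.2 hB
    have := Real.sqrt_pos.2 hT
    field_simp
    rw [Real.sqrt_sq (Real.sqrt_nonneg _)]
  have h2 : T * (2 * (1 / B) * D / T / (2 * (1 / B))) = D := by field_simp
  rw [hsq, h2] at h
  exact le_of_mul_le_mul_left (by linarith) hpos

/-! ### Regret of the rounded states -/

/-- The slots are rounded independently, so only the law of each slot matters. -/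
theorem infidaGain_eq (ord : net.CostOrder) (round : V → (M → ℝ) → PMF (M → Bool)) (η : ℝ) (T : ℕ)
    (q : ℕ → Input V M Req) :
    infidaGain ord round η T q = ∑ t ∈ Finset.range T, ∫ x, gain ord (q t) (toVec x)
      ∂(Measure.pi fun v => (round v (infidaState ord η q t v)).toMeasure) := by
  unfold infidaGain
  rw [integral_finsetSum _ fun _ _ => .of_finite, ← Fin.sum_univ_eq_sum_range fun t =>
    ∫ x, gain ord (q t) (toVec x)
      ∂(Measure.pi fun v => (round v (infidaState ord η q t v)).toMeasure)]
  exact Finset.sum_congr rfl fun t _ => integral_comp_eval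
    (μ := fun t : Fin T => Measure.pi fun v => (round v (infidaState ord η q t v)).toMeasure)
    (f := fun x => gain ord (q t) (toVec x)) Integrable.of_finite.aestronglyMeasurable

theorem fractional_regret_le [Nonempty V] [Nonempty M] (ord : net.CostOrder)
    (hpos : ∀ v, (net.fracAlloc v ∩ posOrthant M).Nonempty) {R L : ℕ} {Δ : ℝ}
    (hR : ∀ q ∈ net.adversary, (Finset.univ.filter fun ρ => q.1 ρ ≠ 0).card ≤ R)
    (hL : ∀ v m, net.capacity v m ≤ L) (hΔ_nonneg : 0 ≤ Δ)
    (hΔ : ∀ ρ, ∀ v ∈ net.path ρ, ∀ m, net.taskOf m = net.task ρ →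
      (∑ m' with net.taskOf m' = net.task ρ,
        toVec net.repo (net.repoNode ρ) m' * net.serveCost ρ (net.repoNode ρ) m') -
          net.serveCost ρ v m ≤ Δ)
    {T : ℕ} {q : ℕ → Input V M Req} (hq : ∀ t < T, q t ∈ net.adversary)
    {x : V → M → Bool} (hx : x ∈ net.intAlloc) :
    ∑ t ∈ Finset.range T, gain ord (q t) (toVec x) ≤
      ∑ t ∈ Finset.range T, gain ord (q t) (infidaState ord (net.learningRate R L Δ T) q t) +
        net.lipBound R L Δ * √(net.sizeMax * Fintype.card V * Fintype.card M) *
          √(2 * net.divBound) * √T := by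
  set η := net.learningRate R L Δ T with hη
  choose u hu hxu using exists_fracAlloc_ge hx
  have hxc : toVec x ∈ net.coverAlloc := fun v m => by
    refine ⟨?_, ?_, (hx v).2 m⟩ <;> · unfold toVec; split_ifs <;> simp
  have huc := coverAlloc_of_fracAlloc hu
  have hyc : ∀ t, infidaState ord η q t ∈ net.coverAlloc := fun t =>
    coverAlloc_of_fracAlloc fun v => (infidaState_mem hpos ord η q t v).1
  have hg : ∀ t < T, ∀ v m, 0 ≤ subgrad ord (q t) (infidaState ord η q t) v m ∧
      subgrad ord (q t) (infidaState ord η q t) v m ≤ R * L * Δ := fun t ht v m =>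
    subgrad_bounds ord hR hL hΔ_nonneg hΔ (hq t ht) (hyc t) v m
  set Q := ∑ t ∈ Finset.range T, ∑ v, ∑ m, subgrad ord (q t) (infidaState ord η q t) v m *
    (u v m - infidaState ord η q t v m) with hQ
  have hlin : ∑ t ∈ Finset.range T, gain ord (q t) (toVec x) ≤
      ∑ t ∈ Finset.range T, gain ord (q t) (infidaState ord η q t) + Q := by
    rw [hQ, ← Finset.sum_add_distrib]
    refine Finset.sum_le_sum fun t ht => ?_
    have ht' := hq t (Finset.mem_range.1 ht)
    have h1 := gain_mono ord ht' hxc huc hxu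
    have h2 := gain_sub_gain_le ord ht' huc (hyc t)
    linarith
  refine hlin.trans (add_le_add_right ?_ _)
  have hsmin := sizeMin_pos (net := net)
  have hD : 0 ≤ net.divBound := Finset.sum_nonneg fun v _ => divBound_term_nonneg v
  have hσ : 0 ≤ net.lipBound R L Δ := by unfold lipBound; positivity
  have hrhs : 0 ≤ net.lipBound R L Δ * √(net.sizeMax * Fintype.card V * Fintype.card M) *
      √(2 * net.divBound) * √T := by positivity
  have hzero : (∀ t < T, ∀ v m, subgrad ord (q t) (infidaState ord η q t) v m *
      (u v m - infidaState ord η q t v m) = 0) → Q = 0 := fun h =>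
    Finset.sum_eq_zero fun t ht => Finset.sum_eq_zero fun v _ => Finset.sum_eq_zero fun m _ =>
      h t (Finset.mem_range.1 ht) v m
  -- the learning rate is `0` if `σ`, `T` or `D` vanishes; then the linear regret vanishes too
  rcases hσ.eq_or_lt with hσ0 | hσ0
  · have h0 : (R * L * Δ : ℝ) = 0 := (div_eq_zero_iff.1 hσ0.symm).resolve_right hsmin.ne'
    refine (hzero fun t ht v m => ?_).trans_le hrhs
    rw [le_antisymm (h0 ▸ (hg t ht v m).2) (hg t ht v m).1, zero_mul]
  rcases Nat.eq_zero_or_pos T with hT | hT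
  · exact (hzero fun t ht => absurd ht (by omega)).trans_le hrhs
  rcases hD.eq_or_lt with hD0 | hD0
  · refine (hzero fun t ht v m => ?_).trans_le hrhs
    rw [fracAlloc_eq_one_of_divBound hD0.symm (hu v),
      fracAlloc_eq_one_of_divBound hD0.symm (infidaState_mem hpos ord η q t v).1, sub_self,
      mul_zero]
  have hB : 0 < net.sizeMax * Fintype.card V * Fintype.card M :=
    mul_pos (mul_pos sizeMax_pos (by exact_mod_cast Fintype.card_pos))
      (by exact_mod_cast Fintype.card_pos)
  exact le_of_balanced_rate hσ0 hB hD0 (by exact_mod_cast hT)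
    (infidaState_linear_regret hpos ord η q hg hu)

end InferenceNetwork

open InferenceNetwork in
theorem theorem1 {V N M Req : Type*} [Fintype V] [DecidableEq V] [DecidableEq N]
    [Fintype M] [DecidableEq M] [Fintype Req]
    (net : InferenceNetwork V N M Req) (ord : net.CostOrder)
    (hpos : ∀ v, (net.fracAlloc v ∩ InferenceNetwork.posOrthant M).Nonempty)
    (round : V → (M → ℝ) → PMF (M → Bool))
    (hround : ∀ v y, (∀ m, 0 ≤ y m ∧ y m ≤ 1) → IsDepRound (net.size v) y (round v y))
    (R L : ℕ) (Δ : ℝ)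
    (hR : ∀ q ∈ net.adversary, (Finset.univ.filter fun ρ => q.1 ρ ≠ 0).card ≤ R)
    (hL : ∀ v m, net.capacity v m ≤ L)
    (hΔ_nonneg : 0 ≤ Δ)
    (hΔ : ∀ ρ, ∀ v ∈ net.path ρ, ∀ m, net.taskOf m = net.task ρ →
      (∑ m' with net.taskOf m' = net.task ρ,
        toVec net.repo (net.repoNode ρ) m' * net.serveCost ρ (net.repoNode ρ) m') -
          net.serveCost ρ v m ≤ Δ)
    (T : ℕ) :
    InferenceNetwork.infidaRegret ord round (net.learningRate R L Δ T) (1 - 1 / Real.exp 1) T ≤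
      ((net.regretConst R L Δ * √(T : ℝ) : ℝ) : EReal) := by
  refine iSup₂_le fun q hq => EReal.coe_le_coe_iff.2 ?_
  have hψ : 0 ≤ 1 - 1 / Real.exp 1 := by
    rw [sub_nonneg, div_le_one (Real.exp_pos 1)]; exact Real.one_le_exp zero_le_one
  rcases isEmpty_or_nonempty Req with hReq | ⟨⟨ρ₀⟩⟩
  · -- without request types all gains vanish
    have h0 : ∀ (q : Input V M Req) (y : V → M → ℝ), gain ord q y = 0 := fun q y => by
      simp [gain, cost]
    have hmin := sizeMin_nonneg (net := net)
    simp only [bestStaticGain, infidaGain, h0, Finset.sum_const_zero, integral_zero,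
      Real.iSup_const_zero, mul_zero, sub_zero, regretConst]
    positivity
  · have : Nonempty M := ⟨(net.repo_end ρ₀).choose⟩
    have : Nonempty V := ⟨net.repoNode ρ₀⟩
    have : Nonempty net.intAlloc := ⟨⟨net.repo, repo_mem_intAlloc hpos⟩⟩
    set η := net.learningRate R L Δ T with hη
    have hbest : bestStaticGain ord T q ≤
        ∑ t ∈ Finset.range T, gain ord (q t) (infidaState ord η q t) +
          net.lipBound R L Δ * √(net.sizeMax * Fintype.card V * Fintype.card M) *
            √(2 * net.divBound) * √T := by
      refine ciSup_le fun x => ?_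
      rw [Fin.sum_univ_eq_sum_range fun t => gain ord (q t) (toVec x.1)]
      exact fractional_regret_le ord hpos hR hL hΔ_nonneg hΔ hq x.2
    have hexp : (1 - 1 / Real.exp 1) *
        ∑ t ∈ Finset.range T, gain ord (q t) (infidaState ord η q t) ≤
        infidaGain ord round η T q := by
      rw [infidaGain_eq, Finset.mul_sum]
      refine Finset.sum_le_sum fun t ht => ?_
      have hy : ∀ v, infidaState ord η q t v ∈ net.fracAlloc v := fun v =>
        (infidaState_mem hpos ord η q t v).1
      exact integral_gain_ge ord (hq t (Finset.mem_range.1 ht)) (coverAlloc_of_fracAlloc hy)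
        fun v => hround v _ (hy v).1
    have h := mul_le_mul_of_nonneg_left hbest hψ
    rw [mul_add] at h
    have hA : net.regretConst R L Δ * √(T : ℝ) = (1 - 1 / Real.exp 1) *
        (net.lipBound R L Δ * √(net.sizeMax * Fintype.card V * Fintype.card M) *
          √(2 * net.divBound) * √T) := by
      unfold regretConst lipBound; ring
    rw [hA]
    linarith

end
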